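/- All functions are real-valued. Conventions: $\hat u(\xi)=\int_{\mathbb R}e^{-ix\xi}u(x)\,dx$ and $\|u\|_{\dot H^\sigma}^2=(2\pi)^{-1}\int_{\mathbb R}|\xi|^{2\sigma}|\hat u(\xi)|^2\,d\xi$; for $\alpha\neq 0$, $\Delta_\alpha u(x)=\frac{u(x)-u(x-\alpha)}{\alpha}$. For functions $f,g$ on $\mathbb R$ put $$\mathcal E(\alpha,\cdot)=\frac12\frac{(\Delta_\alpha f)^2}{1+(\Delta_\alpha f)^2}+\frac12\frac{(\Delta_{-\alpha} f)^2}{1+(\Delta_{-\alpha} f)^2},\qquad \mathcal O(\alpha,\cdot)=\frac12\frac{(\Delta_\alpha f)^2}{1+(\Delta_\alpha f)^2}-\frac12\frac{(\Delta_{-\alpha} f)^2}{1+(\Delta_{-\alpha} f)^2},$$ $$R(f,g)(x)=-\frac1\pi\,\mathrm{pv}\!\int_{\mathbb R}\partial_x\Delta_\alpha g(x)\Big(\mathcal E(\alpha,x)-\frac{(\partial_xf(x))^2}{1+(\partial_xf(x))^2}\Big)d\alpha+\frac1\pi\int_{\mathbb R}\frac{\partial_xg(x-\alpha)}{\alpha}\,\mathcal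 O(\alpha,x)\,d\alpha,$$ where $\mathrm{pv}\int$ denotes the limit as $\varepsilon\to0^+$ of the integral over $\{\varepsilon<|\alpha|<1/\varepsilon\}$. Let $\kappa\colon[0,\infty)\to[1,\infty)$ be nondecreasing with $\kappa(r)\to\infty$ as $r\to\infty$, such that $\kappa(2r)\le c_0\kappa(r)$ for all $r\ge0$ and some constant $c_0>0$, and such that $r\mapsto\kappa(r)/\log(4+r)$ is nonincreasing on $[0,\infty)$. Put $$\phi(\lambda)=\int_0^\infty\frac{1-\cos h}{h^2}\,\kappa\Big(\frac{\lambda}{h}\Big)\,dh\qquad(\lambda\ge0),$$ and for $s\ge 0$ let $|D|^{s,\phi}$ be the Fourier multiplier with symbol $|\xi|^s\phi(|\xi|)$. **Proposition.** There is a constant $C>0$ such that: (a) for all $f,g\in\mathcal S(\mathbb R)$, the function $R(f,g)$ is well defined at every point, belongs to $L^2(\mathbb R)$, and $$\|R(f,g)\|_{L^2}\le C\,\|g\|_{\dot H^{3/4}}\,\|f\|_{\dot H^{7/4}};$$ (b) for all $f\in\mathcal S(\mathbb R)$, the functions $|\xi|\phi(|\xi|)\hat f(\xi)$ and $|\xi|^{7/4}\phi(|\xi|)\hat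 f(\xi)$ are integrable (so that $|D|^{1,\phi}f$ and $|D|^{7/4,\phi}f$ are given by inverse Fourier integrals), $|D|^{1,\phi}f$ is differentiable, $|D|^{7/4,\phi}f\in L^2(\mathbb R)$, the function $R(f,|D|^{1,\phi}f)$ is well defined at every point, belongs to $L^2(\mathbb R)$, and $$\|R(f,|D|^{1,\phi}f)\|_{L^2}\le C\,\big\||D|^{7/4,\phi}f\big\|_{L^2}\,\|f\|_{\dot H^{7/4}}.$$ -/

import Mathlib

open MeasureTheory Set Filter Topology

noncomputable section

namespace Muskat

/-! ### Weights, Fourier multipliers and homogeneous Sobolev norms -/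

/-- The standing assumptions on a weight `κ : [0,∞) → [1,∞)`; only the values of `κ` on `[0,∞)`
are constrained. "Increasing" and "decreasing" are meant in the wide sense. -/
structure IsWeight (κ : ℝ → ℝ) : Prop where
  one_le : ∀ r, 0 ≤ r → 1 ≤ κ r
  monotoneOn : MonotoneOn κ (Ici 0)
  tendsto_atTop : Tendsto κ atTop atTop
  doubling : ∃ c₀ : ℝ, 0 < c₀ ∧ ∀ r, 0 ≤ r → κ (2 * r) ≤ c₀ * κ r
  antitoneOn_div_log : AntitoneOn (fun r => κ r / Real.log (4 + r)) (Ici 0)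

/-- `φ(t) = ∫₀^∞ (1 - cos h) / h² κ(t / h) dh`. -/
def phi (κ : ℝ → ℝ) (t : ℝ) : ℝ :=
  ∫ h in Ioi (0 : ℝ), (1 - Real.cos h) / h ^ 2 * κ (t / h)

/-- The Fourier transform `û(ξ) = ∫ e^{-i x ξ} u(x) dx` (Mathlib's `𝓕` has the kernel
`e^{-2 π i x ξ}`). -/
def hat (u : ℝ → ℝ) (ξ : ℝ) : ℂ :=
  FourierTransform.fourier (fun x : ℝ => (u x : ℂ)) (ξ / (2 * Real.pi))

/-- The homogeneous Sobolev norm, `‖u‖² = (2π)⁻¹ ∫ |ξ|^{2σ} |û(ξ)|² dξ`. -/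
def hDotNorm (σ : ℝ) (u : ℝ → ℝ) : ℝ :=
  Real.sqrt ((2 * Real.pi)⁻¹ * ∫ ξ : ℝ, |ξ| ^ (2 * σ) * ‖hat u ξ‖ ^ 2)

/-- The `L²` norm. -/
def l2Norm (u : ℝ → ℝ) : ℝ := (eLpNorm u 2 volume).toReal

/-- The Fourier transform `|ξ|^s φ(|ξ|) û(ξ)` of `|D|^{s,φ} u`. -/
def multiplierHat (s : ℝ) (φ : ℝ → ℝ) (u : ℝ → ℝ) (ξ : ℝ) : ℂ :=
  ((|ξ| ^ s * φ |ξ| : ℝ) : ℂ) * hat u ξ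

/-- The inverse Fourier transform of `|ξ|^s φ(|ξ|) û(ξ)`, with complex values. -/
def multiplierC (s : ℝ) (φ : ℝ → ℝ) (u : ℝ → ℝ) (x : ℝ) : ℂ :=
  (2 * (Real.pi : ℂ))⁻¹ *
    ∫ ξ : ℝ, Complex.exp (Complex.I * (x : ℂ) * (ξ : ℂ)) * multiplierHat s φ u ξ

/-- `|D|^{s,φ} u`, as a real-valued function; taking the real part loses nothing, see
`ofReal_multiplier`. -/
def multiplier (s : ℝ) (φ : ℝ → ℝ) (u : ℝ → ℝ) (x : ℝ) : ℝ :=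
  (multiplierC s φ u x).re

/-! ### Finite differences and the remainder -/

/-- The slope `Δ_α u (x) = (u(x) - u(x - α)) / α`. -/
def slope (α : ℝ) (u : ℝ → ℝ) (x : ℝ) : ℝ := (u x - u (x - α)) / α

/-- `F(y) = y² / (1 + y²)`. -/
def F (y : ℝ) : ℝ := y ^ 2 / (1 + y ^ 2)

/-- The part of `F(Δ_α f)` that is even in `α`. -/
def evenPart (f : ℝ → ℝ) (α x : ℝ) : ℝ := F (slope α f x) / 2 + F (slope (-α) f x) / 2

/-- The part of `F(Δ_α f)` that is odd in `α`. -/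
def oddPart (f : ℝ → ℝ) (α x : ℝ) : ℝ := F (slope α f x) / 2 - F (slope (-α) f x) / 2

/-- The truncated domain `{ε < |α| < 1/ε}`. -/
def trunc (ε : ℝ) : Set ℝ := {α | ε < |α| ∧ |α| < ε⁻¹}

/-- The integral of `h` over the line converges to `I` as a principal value (at `0` and at `∞`). -/
def HasPV (h : ℝ → ℝ) (I : ℝ) : Prop :=
  (∀ ε, 0 < ε → IntegrableOn h (trunc ε)) ∧
    Tendsto (fun ε => ∫ α in trunc ε, h α) (𝓝[>] 0) (𝓝 I)

/-- The principal value of the integral of `h` (meaningful if `∃ I, HasPV h I`). -/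
def pv (h : ℝ → ℝ) : ℝ := limUnder (𝓝[>] (0 : ℝ)) (fun ε => ∫ α in trunc ε, h α)

/-- The first integrand, `∂ₓ(Δ_α g)(x) (E(α,x) - f'(x)² / (1 + f'(x)²))`. -/
def integrandE (f g : ℝ → ℝ) (x α : ℝ) : ℝ :=
  deriv (slope α g) x * (evenPart f α x - F (deriv f x))

/-- The second integrand, `g'(x - α) / α · O(α,x)`. -/
def integrandO (f g : ℝ → ℝ) (x α : ℝ) : ℝ :=
  deriv g (x - α) / α * oddPart f α x

/-- The remainder `R(f,g)`. The first integrand has a tail of order `1/α` that is odd in `α`, so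
that the first integral is a principal value; the second one converges absolutely. -/
def remainder (f g : ℝ → ℝ) (x : ℝ) : ℝ :=
  -(1 / Real.pi) * pv (integrandE f g x) + (1 / Real.pi) * ∫ α : ℝ, integrandO f g x α

/-- Every expression in the definition of `R(f,g)` is meaningful, at every point. -/
def RemainderExists (f g : ℝ → ℝ) : Prop :=
  Differentiable ℝ f ∧ Differentiable ℝ g ∧
    (∀ x, ∃ I, HasPV (integrandE f g x) I) ∧ ∀ x, Integrable (integrandO f g x)

/-! ### `|D|^{s,φ} u` is real-valued -/

lemma conj_hat (u : ℝ → ℝ) (ξ : ℝ) : (starRingEnd ℂ) (hat u ξ) = hat u (-ξ) := by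
  unfold hat
  rw [Real.fourier_real_eq_integral_exp_smul, Real.fourier_real_eq_integral_exp_smul, ← integral_conj]
  congr 1
  ext x
  simp only [smul_eq_mul, map_mul, Complex.conj_ofReal, ← Complex.exp_conj, Complex.conj_I]
  congr 2
  push_cast
  ring

lemma ofReal_multiplier (s : ℝ) (φ u : ℝ → ℝ) (x : ℝ) :
    (multiplier s φ u x : ℂ) = multiplierC s φ u x := by
  unfold multiplier
  rw [← Complex.conj_eq_iff_re]
  unfold multiplierC
  rw [map_mul, ← integral_conj, ← integral_neg_eq_self]
  congr 1
  · simp [Complex.conj_ofNat]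
  · congr 1
    ext ξ
    simp only [multiplierHat, map_mul, conj_hat, Complex.conj_ofReal, ← Complex.exp_conj,
      Complex.conj_I, abs_neg, neg_neg]
    congr 2
    push_cast
    ring

end Muskat

end

open scoped FourierTransform ContDiff ENNReal

noncomputable section

namespace Muskat

/-! Write `Δ_α` for `slope α` and `F(y) = y²/(1+y²)`. Since `∂ₓΔ_α g(x) = (g'(x) - g'(x-α))/α`, the
first integrand of the remainder splits into `g'(x)` times a kernel odd in `α`, which integrates to
zero over every symmetric truncation, and an absolutely convergent piece. That piece combines with
the second integral: the even and odd halves recombine and `R(f,g)(x) = π⁻¹ ∫ g'(x-α) (F(Δ_α f) -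
F(f'))/α dα` (`remainder_eq`).

The identity `∂_α Δ_α u = (u'(x-α) - Δ_α u)/α` then permits an integration by parts in `α` that
removes the derivative from `g` (`integral_deriv_mul_increment`). As `F` is 1-Lipschitz, the
nonlinearity disappears from the estimates: the new integrand is at most `|Δ_α g|` times `|f'(x-α) -
Δ_α f|/|α| + |Δ_α f - f'|/|α|`.

Cauchy–Schwarz in `α` and then in `x` bounds the squared `L²` norm by a product of two square
functions, `∫ ‖Δ_α g‖²_{L⁴} dα` and `∫ ‖(Δ_α f - f')/α‖²_{L⁴} dα` (`lintegral_sq_lintegral_mul_le`).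
The embedding of `Ḣ^{1/4}` into `L⁴` makes each a quadratic Fourier integral. By Tonelli it remains
to integrate a squared symbol over `α`, which gives `|ξ|` in the first case and `|ξ|³` in the
second, up to constants; hence `Ḣ^{3/4}` for `g` and `Ḣ^{7/4}` for `f`
(`lintegral_sqrt_lintegral_fourier_le`).

All of this works for real functions that are Fourier transforms of rapidly decaying functions
(`HasSpectrum`). Schwartz functions are of this kind. So is `|D|^{s,φ} f`, although its symbol need
not be smooth: `φ` is monotone, hence measurable, and grows at most linearly. With `g = |D|^{1,φ}
f`, the `Ḣ^{3/4}` norm of `g` is the `L²` norm of `|D|^{7/4,φ} f`, so (b) follows from the same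
estimate, with the same constant, as (a). -/

/-! ### Rapidly decaying functions and the Plancherel theorem -/

/-- A measurable function that decays faster than every power. -/
structure RapidDecay (w : ℝ → ℂ) : Prop where
  measurable : Measurable w
  bound : ∀ n : ℕ, ∃ C : ℝ, ∀ ξ, |ξ| ^ n * ‖w ξ‖ ≤ C

namespace RapidDecay

variable {w : ℝ → ℂ}

lemma mul_of_le (hw : RapidDecay w) {m : ℝ → ℂ} (hm : Measurable m) (k : ℕ) (C : ℝ)
    (hC : ∀ ξ, ‖m ξ‖ ≤ C * (1 + |ξ| ^ k)) : RapidDecay (fun ξ => m ξ * w ξ) := by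
  refine ⟨hm.mul hw.measurable, fun n => ?_⟩
  obtain ⟨A, hA⟩ := hw.bound n
  obtain ⟨B, hB⟩ := hw.bound (n + k)
  have hC0 : 0 ≤ C := by
    have := (norm_nonneg _).trans (hC 0)
    have h2 : (0 : ℝ) < 1 + |0| ^ k := by positivity
    exact nonneg_of_mul_nonneg_left this h2
  refine ⟨C * (A + B), fun ξ => ?_⟩
  calc |ξ| ^ n * ‖m ξ * w ξ‖ = ‖m ξ‖ * (|ξ| ^ n * ‖w ξ‖) := by rw [norm_mul]; ring
    _ ≤ (C * (1 + |ξ| ^ k)) * (|ξ| ^ n * ‖w ξ‖) := by gcongr; exact hC ξ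
    _ = C * (|ξ| ^ n * ‖w ξ‖ + |ξ| ^ (n + k) * ‖w ξ‖) := by ring
    _ ≤ C * (A + B) := by gcongr; exacts [hA ξ, hB ξ]

lemma integrable (hw : RapidDecay w) : Integrable w := by
  obtain ⟨A, hA⟩ := hw.bound 0
  obtain ⟨B, hB⟩ := hw.bound 2
  refine Integrable.mono' (integrable_inv_one_add_sq.const_mul (A + B))
    hw.measurable.aestronglyMeasurable (ae_of_all _ fun ξ => ?_)
  have h0 := hA ξ
  have h2 := hB ξ
  rw [sq_abs] at h2
  rw [pow_zero, one_mul] at h0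
  rw [← div_eq_mul_inv, le_div_iff₀ (by positivity)]
  linarith

lemma memLp_two (hw : RapidDecay w) : MemLp w 2 := by
  obtain ⟨A, hA⟩ := hw.bound 0
  rw [memLp_two_iff_integrable_sq_norm hw.measurable.aestronglyMeasurable]
  refine Integrable.mono' (hw.integrable.norm.const_mul A)
    (hw.measurable.norm.pow_const 2).aestronglyMeasurable (ae_of_all _ fun ξ => ?_)
  have h0 := hA ξ
  rw [pow_zero, one_mul] at h0
  rw [Real.norm_of_nonneg (by positivity), sq]
  gcongr

lemma const_mul_id (hw : RapidDecay w) (c : ℂ) :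
    RapidDecay (fun ξ => (c * (ξ : ℂ)) * w ξ) := by
  refine hw.mul_of_le (by fun_prop) 1 ‖c‖ fun ξ => ?_
  rw [norm_mul, Complex.norm_real, Real.norm_eq_abs, pow_one]
  have := norm_nonneg c
  nlinarith

lemma indicator (hw : RapidDecay w) {s : Set ℝ} (hs : MeasurableSet s) :
    RapidDecay (s.indicator w) := by
  refine ⟨hw.measurable.indicator hs, fun n => ?_⟩
  obtain ⟨A, hA⟩ := hw.bound n
  refine ⟨A, fun ξ => (mul_le_mul_of_nonneg_left ?_ (by positivity)).trans (hA ξ)⟩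
  exact norm_indicator_le_norm_self w ξ

end RapidDecay

lemma continuous_fourier {w : ℝ → ℂ} (hw : Integrable w) : Continuous (𝓕 w) :=
  VectorFourier.fourierIntegral_continuous Real.continuous_fourierChar
    (by exact continuous_inner) hw

lemma norm_fourier_le {w : ℝ → ℂ} (x : ℝ) : ‖𝓕 w x‖ ≤ ∫ ξ, ‖w ξ‖ :=
  VectorFourier.norm_fourierIntegral_le_integral_norm _ _ _ _ _

/-- The `L²` Fourier transform agrees with the Fourier integral on `L¹ ∩ L²`. -/
lemma fourier_toLp_ae_eq {w : ℝ → ℂ} (h1 : Integrable w) (h2 : MemLp w 2) :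
    (𝓕 (h2.toLp w) : Lp ℂ 2 (volume : Measure ℝ)) =ᵐ[volume] 𝓕 w := by
  have hl : LocallyIntegrable (𝓕 (h2.toLp w) : Lp ℂ 2 (volume : Measure ℝ)) volume :=
    (Lp.memLp _).locallyIntegrable (by norm_num)
  -- Both sides are locally integrable, so it suffices to test against smooth compactly supported
  -- functions and move the transform onto the test function.
  refine ae_eq_of_integral_contDiff_smul_eq hl (continuous_fourier h1).locallyIntegrable
    fun g hg hgs => ?_
  have hgs' : HasCompactSupport (fun x => (g x : ℂ)) := hgs.comp_left Complex.ofReal_zero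
  have hg' : ContDiff ℝ ∞ (fun x => (g x : ℂ)) := Complex.ofRealCLM.contDiff.comp hg
  let φ : SchwartzMap ℝ ℂ := hgs'.toSchwartzMap hg'
  have hφ : ∀ x, φ x = (g x : ℂ) := fun x => rfl
  have e1 := congrArg (fun T => T φ) (Lp.fourier_toTemperedDistribution_eq (h2.toLp w))
  simp only [TemperedDistribution.fourier_apply, Lp.toTemperedDistribution_apply] at e1
  have e2 : ∫ x, (𝓕 φ) x • (h2.toLp w) x = ∫ x, (𝓕 (φ : ℝ → ℂ)) x • w x := by
    refine integral_congr_ae ?_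
    filter_upwards [h2.coeFn_toLp] with x hx
    rw [hx, SchwartzMap.fourier_coe]
  have e3 : ∫ x, (𝓕 (φ : ℝ → ℂ)) x • w x = ∫ x, φ x • 𝓕 w x := by
    simpa using! (VectorFourier.integral_fourierIntegral_smul_eq_flip (L := innerₗ ℝ)
      Real.continuous_fourierChar continuous_inner φ.integrable h1)
  rw [e2, e3] at e1
  simp only [hφ] at e1
  simpa using e1.symm

lemma memLp_fourier {w : ℝ → ℂ} (h1 : Integrable w) (h2 : MemLp w 2) : MemLp (𝓕 w) 2 :=
  (memLp_congr_ae (fourier_toLp_ae_eq h1 h2)).1 (Lp.memLp _)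

lemma eLpNorm_fourier {w : ℝ → ℂ} (h1 : Integrable w) (h2 : MemLp w 2) :
    eLpNorm (𝓕 w) 2 volume = eLpNorm w 2 volume := by
  rw [← eLpNorm_congr_ae (fourier_toLp_ae_eq h1 h2), ← eLpNorm_congr_ae h2.coeFn_toLp,
    ← Lp.enorm_def, ← Lp.enorm_def, ← ofReal_norm, ← ofReal_norm, Lp.norm_fourier_eq]

lemma lintegral_enorm_sq_eq (u : ℝ → ℂ) : ∫⁻ x, ‖u x‖ₑ ^ 2 = eLpNorm u 2 volume ^ 2 := by
  rw [eLpNorm_eq_lintegral_rpow_enorm_toReal (by norm_num) (by norm_num), ← ENNReal.rpow_natCast,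
    ← ENNReal.rpow_mul]
  simp

/-- Plancherel's theorem. -/
lemma RapidDecay.lintegral_fourier {w : ℝ → ℂ} (hw : RapidDecay w) :
    ∫⁻ x, ‖𝓕 w x‖ₑ ^ 2 = ∫⁻ ξ, ‖w ξ‖ₑ ^ 2 := by
  rw [lintegral_enorm_sq_eq, lintegral_enorm_sq_eq, eLpNorm_fourier hw.integrable hw.memLp_two]

/-! ### Tools for lower Lebesgue integrals -/

/-- The Cauchy–Schwarz inequality. -/
lemma sq_lintegral_mul_le {X : Type*} [MeasurableSpace X] {μ : Measure X} {p q : X → ℝ≥0∞}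
    (hp : Measurable p) (hq : Measurable q) :
    (∫⁻ x, p x * q x ∂μ) ^ 2 ≤ (∫⁻ x, p x ^ 2 ∂μ) * ∫⁻ x, q x ^ 2 ∂μ := by
  have h := ENNReal.lintegral_mul_le_Lp_mul_Lq μ Real.HolderConjugate.two_two
    hp.aemeasurable hq.aemeasurable
  have h2 := ENNReal.rpow_le_rpow h (z := 2) (by norm_num)
  rw [ENNReal.mul_rpow_of_nonneg _ _ (by norm_num), ← ENNReal.rpow_mul, ← ENNReal.rpow_mul] at h2
  simpa using h2

lemma lintegral_comp_abs {h : ℝ → ℝ≥0∞} (hh : Measurable h) :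
    ∫⁻ x, h |x| = 2 * ∫⁻ x in Ioi (0 : ℝ), h x := by
  have e1 : ∫⁻ x in Ioi (0 : ℝ), h |x| = ∫⁻ x in Ioi (0 : ℝ), h x :=
    setLIntegral_congr_fun measurableSet_Ioi fun x hx => by rw [abs_of_pos hx]
  have e2 : ∫⁻ x in Iic (0 : ℝ), h |x| = ∫⁻ x in Ioi (0 : ℝ), h x := by
    rw [← e1, setLIntegral_congr (Iio_ae_eq_Iic (μ := volume) (a := (0 : ℝ))).symm]
    have := (Measure.measurePreserving_neg (volume : Measure ℝ)).setLIntegral_comp_preimage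
      (s := Ioi 0) (f := fun x => h |x|) measurableSet_Ioi (by fun_prop)
    rw [← this]
    simp
  rw [← lintegral_add_compl _ (measurableSet_Iic (a := (0 : ℝ))), compl_Iic, e1, e2, two_mul]

lemma lintegral_abs_le_rpow (A : ℝ) (hA : 0 ≤ A) :
    ∫⁻ ξ in {ξ : ℝ | |ξ| ≤ A}, ENNReal.ofReal (|ξ| ^ (-(1 / 2) : ℝ)) =
      ENNReal.ofReal (4 * A ^ (1 / 2 : ℝ)) := by
  have hm : Measurable fun x : ℝ =>
      (Iic A).indicator (fun x => ENNReal.ofReal (x ^ (-(1 / 2) : ℝ))) x :=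
    Measurable.indicator (by fun_prop) measurableSet_Iic
  have e1 : ∫⁻ ξ in {ξ : ℝ | |ξ| ≤ A}, ENNReal.ofReal (|ξ| ^ (-(1 / 2) : ℝ)) =
      ∫⁻ ξ, (Iic A).indicator (fun x => ENNReal.ofReal (x ^ (-(1 / 2) : ℝ))) |ξ| := by
    rw [← lintegral_indicator (measurableSet_le (by fun_prop) (by fun_prop))]
    rfl
  have hi : IntervalIntegrable (fun x : ℝ => x ^ (-(1 / 2) : ℝ)) volume 0 A :=
    intervalIntegral.intervalIntegrable_rpow' (by norm_num)
  rw [e1, lintegral_comp_abs hm, lintegral_indicator measurableSet_Iic,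
    Measure.restrict_restrict measurableSet_Iic, inter_comm, Ioi_inter_Iic,
    ← ofReal_integral_eq_lintegral_ofReal
      ((intervalIntegrable_iff_integrableOn_Ioc_of_le hA).1 hi)
      ((ae_restrict_iff' measurableSet_Ioc).2 (ae_of_all _ fun x hx => by
        have := hx.1.le; positivity)),
    ← intervalIntegral.integral_of_le hA, integral_rpow (Or.inl (by norm_num))]
  rw [show (2 : ℝ≥0∞) = ENNReal.ofReal 2 by simp, ← ENNReal.ofReal_mul (by norm_num)]
  congr 1
  norm_num
  ring

/-- The two bounds are used on either side of `|α| = 1/a`; each half-line contributes at most `a +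
4a`. With `a = 2π|ξ|` this is where integrating in `α` gains one power of `|ξ|`. -/
lemma lintegral_min_sq_le (a : ℝ) (ha : 0 ≤ a) :
    ∫⁻ α : ℝ, ENNReal.ofReal (min (a ^ 2) (4 / α ^ 2)) ≤ ENNReal.ofReal (10 * a) := by
  rcases ha.eq_or_lt with rfl | ha
  · simp
  have hm : Measurable fun α : ℝ => ENNReal.ofReal (min (a ^ 2) (4 / α ^ 2)) := by fun_prop
  have h0 : (0 : ℝ) < a⁻¹ := by positivity
  have h1 : ∫⁻ α in Ioc 0 a⁻¹, ENNReal.ofReal (min (a ^ 2) (4 / α ^ 2)) ≤ ENNReal.ofReal a := by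
    calc _ ≤ ∫⁻ α in Ioc 0 a⁻¹, ENNReal.ofReal (a ^ 2) :=
          lintegral_mono fun α => ENNReal.ofReal_le_ofReal (min_le_left _ _)
      _ = ENNReal.ofReal a := by
          rw [setLIntegral_const, Real.volume_Ioc, sub_zero, ← ENNReal.ofReal_mul (by positivity)]
          congr 1
          field_simp
  have h2 : ∫⁻ α in Ioi a⁻¹, ENNReal.ofReal (min (a ^ 2) (4 / α ^ 2)) ≤ ENNReal.ofReal (4 * a) := by
    have hi : IntegrableOn (fun α : ℝ => 4 * α ^ (-2 : ℝ)) (Ioi a⁻¹) :=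
      (integrableOn_Ioi_rpow_of_lt (by norm_num) h0).const_mul 4
    have hpos : ∀ α ∈ Ioi a⁻¹, 4 / α ^ 2 = 4 * α ^ (-2 : ℝ) := fun α hα => by
      rw [Real.rpow_neg (h0.trans hα).le, Real.rpow_two, div_eq_mul_inv]
    calc _ ≤ ∫⁻ α in Ioi a⁻¹, ENNReal.ofReal (4 * α ^ (-2 : ℝ)) :=
          setLIntegral_mono (by fun_prop) fun α hα =>
            ENNReal.ofReal_le_ofReal ((min_le_right _ _).trans (hpos α hα).le)
      _ = ENNReal.ofReal (4 * a) := by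
          rw [← ofReal_integral_eq_lintegral_ofReal hi
            ((ae_restrict_iff' measurableSet_Ioi).2 (ae_of_all _ fun x hx => by
              have := (h0.trans hx).le; positivity)), integral_const_mul,
            integral_Ioi_rpow_of_lt (by norm_num) h0]
          congr 2
          norm_num
          rw [Real.rpow_neg_one, inv_inv]
  have h3 := lintegral_comp_abs hm
  simp only [sq_abs] at h3
  rw [h3, ← Ioc_union_Ioi_eq_Ioi h0.le, lintegral_union measurableSet_Ioi
    (Ioc_disjoint_Ioi le_rfl)]
  calc _ ≤ 2 * (ENNReal.ofReal a + ENNReal.ofReal (4 * a)) := by gcongr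
    _ = ENNReal.ofReal (10 * a) := by
      rw [← ENNReal.ofReal_add (by positivity) (by positivity),
        show (2 : ℝ≥0∞) = ENNReal.ofReal 2 by simp, ← ENNReal.ofReal_mul (by norm_num)]
      congr 1
      ring

/-! ### Linearity of the Fourier integral -/

lemma fourier_add {w v : ℝ → ℂ} (hw : Integrable w) (hv : Integrable v) :
    𝓕 (w + v) = 𝓕 w + 𝓕 v :=
  VectorFourier.fourierIntegral_add Real.continuous_fourierChar (by exact continuous_inner) hw hv

lemma fourier_const_smul (c : ℂ) (w : ℝ → ℂ) : 𝓕 (c • w) = c • 𝓕 w :=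
  VectorFourier.fourierIntegral_const_smul _ _ _ _ _

lemma fourier_sub {w v : ℝ → ℂ} (hw : Integrable w) (hv : Integrable v) :
    𝓕 (w - v) = 𝓕 w - 𝓕 v := by
  have := fourier_const_smul (-1) v
  rw [sub_eq_add_neg, fourier_add hw hv.neg, ← neg_one_smul ℂ v, this, neg_one_smul,
    sub_eq_add_neg]

/-! ### The Sobolev embedding of `Ḣ^{1/4}` into `L⁴` -/

/-- Cauchy–Schwarz after inserting `|ξ|^{1/4} |ξ|^{-1/4}`; the weight `|ξ|^{-1/2}` is integrable on
the low frequencies. -/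
lemma enorm_fourier_indicator_sq_le {w : ℝ → ℂ} (hw : Measurable w) (A : ℝ) (hA : 0 ≤ A) (x : ℝ) :
    ‖𝓕 ({ξ : ℝ | |ξ| ≤ A}.indicator w) x‖ₑ ^ 2 ≤
      (∫⁻ ξ, ENNReal.ofReal (|ξ| ^ (1 / 2 : ℝ)) * ‖w ξ‖ₑ ^ 2) *
        ENNReal.ofReal (4 * A ^ (1 / 2 : ℝ)) := by
  have hs : MeasurableSet {ξ : ℝ | |ξ| ≤ A} := measurableSet_le (by fun_prop) (by fun_prop)
  have h1 : ‖𝓕 ({ξ : ℝ | |ξ| ≤ A}.indicator w) x‖ₑ ≤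
      ∫⁻ ξ in {ξ : ℝ | |ξ| ≤ A}, ‖w ξ‖ₑ := by
    rw [Real.fourier_real_eq]
    refine (enorm_integral_le_lintegral_enorm _).trans ?_
    rw [← lintegral_indicator hs]
    refine (lintegral_congr fun ξ => ?_).le
    rw [Circle.smul_def, enorm_smul, ← ofReal_norm, Circle.norm_coe, enorm_indicator_eq_indicator_enorm]
    simp
  have h2 : ∫⁻ ξ in {ξ : ℝ | |ξ| ≤ A}, ‖w ξ‖ₑ =
      ∫⁻ ξ in {ξ : ℝ | |ξ| ≤ A}, (ENNReal.ofReal (|ξ| ^ (1 / 4 : ℝ)) * ‖w ξ‖ₑ) *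
        ENNReal.ofReal (|ξ| ^ (-(1 / 4) : ℝ)) := by
    refine lintegral_congr_ae (ae_restrict_of_ae ?_)
    filter_upwards [Measure.ae_ne volume (0 : ℝ)] with ξ hξ
    have : 0 < |ξ| := abs_pos.2 hξ
    rw [mul_right_comm, ← ENNReal.ofReal_mul (by positivity), ← Real.rpow_add this]
    simp
  refine (pow_le_pow_left' (h1.trans h2.le) 2).trans
    ((sq_lintegral_mul_le (by fun_prop) (by fun_prop)).trans ?_)
  refine mul_le_mul' ?_ ?_
  · refine (setLIntegral_le_lintegral _ _).trans (lintegral_mono fun ξ => ?_)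
    rw [mul_pow, ← ENNReal.ofReal_pow (by positivity), ← Real.rpow_natCast,
      ← Real.rpow_mul (abs_nonneg ξ)]
    norm_num
  · rw [← lintegral_abs_le_rpow A hA]
    refine lintegral_mono fun ξ => ?_
    rw [← ENNReal.ofReal_pow (by positivity), ← Real.rpow_natCast,
      ← Real.rpow_mul (abs_nonneg ξ)]
    norm_num

/-- The Sobolev embedding of `Ḣ^{1/4}` into `L⁴`, on the Fourier side. -/
lemma RapidDecay.lintegral_fourier_pow_four_le {w : ℝ → ℂ} (hw : RapidDecay w) :
    ∫⁻ x, ‖𝓕 w x‖ₑ ^ 4 ≤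
      256 * (∫⁻ ξ, ENNReal.ofReal (|ξ| ^ (1 / 2 : ℝ)) * ‖w ξ‖ₑ ^ 2) ^ 2 := by
  set I := ∫⁻ ξ, ENNReal.ofReal (|ξ| ^ (1 / 2 : ℝ)) * ‖w ξ‖ₑ ^ 2 with hI
  have hwm : Measurable w := hw.measurable
  rcases eq_or_ne I ⊤ with htop | htop
  · simp [htop]
  rcases eq_or_ne I 0 with h0 | h0
  · have hw0 : w =ᵐ[volume] 0 := by
      have h0' := (lintegral_eq_zero_iff (by fun_prop)).1 h0
      filter_upwards [h0', Measure.ae_ne volume (0 : ℝ)] with ξ h1 h2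
      have : 0 < |ξ| ^ (2⁻¹ : ℝ) := Real.rpow_pos_of_pos (abs_pos.2 h2) _
      simpa [this.not_ge] using h1
    have : ∀ x, 𝓕 w x = 0 := fun x => by
      rw [Real.fourier_real_eq]
      refine integral_eq_zero_of_ae ?_
      filter_upwards [hw0] with ξ hξ
      simp [hξ]
    simp [this]
  -- `N` is the `Ḣ^{1/4}` size of `w`, finite and nonzero here, so it may appear in the frequency
  -- cut-off.
  set N := √I.toReal with hN
  have hN0 : 0 < N := Real.sqrt_pos.2 (ENNReal.toReal_pos h0 htop)
  have hIN : I = ENNReal.ofReal (N ^ 2) := by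
    rw [hN, Real.sq_sqrt ENNReal.toReal_nonneg, ENNReal.ofReal_toReal htop]
  -- The cut-off depends on the level `t` and is chosen so that the low-frequency part is at most
  -- `t/2`: `N² · 4 A(t)^{1/2} = (t/2)²`. The level set at height `t` is then governed by the high
  -- frequencies alone, through Chebyshev and Plancherel.
  let A : ℝ → ℝ := fun t => (t / (4 * N)) ^ 4
  have hA : ∀ t, 0 ≤ A t := fun t => by positivity
  have hset : ∀ t, MeasurableSet {ξ : ℝ | |ξ| ≤ A t} := fun t =>
    measurableSet_le (by fun_prop) (by fun_prop)
  have hu : Continuous (𝓕 w) := continuous_fourier hw.integrable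
  have hlayer : ∀ t ∈ Ioi (0 : ℝ), volume {x | t < ‖𝓕 w x‖} * ENNReal.ofReal (t ^ (4 - 1 : ℝ)) ≤
      ENNReal.ofReal (4 * t) * ∫⁻ ξ, {ξ : ℝ | |ξ| ≤ A t}ᶜ.indicator (fun ξ => ‖w ξ‖ₑ ^ 2) ξ := by
    intro t (ht : 0 < t)
    let lo := {ξ : ℝ | |ξ| ≤ A t}.indicator w
    let hi := {ξ : ℝ | |ξ| ≤ A t}ᶜ.indicator w
    have hlo : RapidDecay lo := hw.indicator (hset t)
    have hhi : RapidDecay hi := hw.indicator (hset t).compl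
    have hsum : ∀ x, 𝓕 w x = 𝓕 lo x + 𝓕 hi x := fun x => by
      rw [← Pi.add_apply, ← fourier_add hlo.integrable hhi.integrable,
        Set.indicator_self_add_compl]
    have hlo_le : ∀ x, ‖𝓕 lo x‖ ≤ t / 2 := fun x => by
      have h := enorm_fourier_indicator_sq_le hwm (A t) (hA t) x
      rw [← hI, hIN, ← ENNReal.ofReal_mul (by positivity), ← ofReal_norm,
        ← ENNReal.ofReal_pow (norm_nonneg _), ENNReal.ofReal_le_ofReal_iff (by positivity)] at h
      have e : N ^ 2 * (4 * A t ^ (1 / 2 : ℝ)) = (t / 2) ^ 2 := by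
        have : A t ^ (1 / 2 : ℝ) = (t / (4 * N)) ^ 2 := by
          rw [← Real.sqrt_eq_rpow, show A t = ((t / (4 * N)) ^ 2) ^ 2 by simp only [A]; ring,
            Real.sqrt_sq (by positivity)]
        rw [this]
        field_simp
        norm_num
      rw [e] at h
      exact (sq_le_sq₀ (norm_nonneg _) (by positivity)).1 h
    have hsub : {x | t < ‖𝓕 w x‖} ⊆ {x | ENNReal.ofReal (t / 2) ^ 2 ≤ ‖𝓕 hi x‖ₑ ^ 2} := by
      intro x (hx : t < ‖𝓕 w x‖)
      have h1 := hlo_le x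
      have h2 := norm_add_le (𝓕 lo x) (𝓕 hi x)
      rw [← hsum] at h2
      refine pow_le_pow_left' (?_ : ENNReal.ofReal (t / 2) ≤ ‖𝓕 hi x‖ₑ) 2
      rw [← ofReal_norm]
      exact ENNReal.ofReal_le_ofReal (by linarith)
    have hcheb := mul_meas_ge_le_lintegral (μ := volume) (f := fun x => ‖𝓕 hi x‖ₑ ^ 2)
      ((continuous_fourier hhi.integrable).enorm.measurable.pow_const 2)
      (ENNReal.ofReal (t / 2) ^ 2)
    rw [hhi.lintegral_fourier] at hcheb
    have e1 : ENNReal.ofReal (t ^ (4 - 1 : ℝ)) =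
        ENNReal.ofReal (4 * t) * ENNReal.ofReal (t / 2) ^ 2 := by
      rw [← ENNReal.ofReal_pow (by positivity), ← ENNReal.ofReal_mul (by positivity)]
      congr 1
      norm_num
      ring
    have e2 : ∀ ξ, ‖hi ξ‖ₑ ^ 2 = {ξ : ℝ | |ξ| ≤ A t}ᶜ.indicator (fun ξ => ‖w ξ‖ₑ ^ 2) ξ := by
      intro ξ
      by_cases h : ξ ∈ {ξ : ℝ | |ξ| ≤ A t}ᶜ
      · simp only [hi, indicator_of_mem h]
      · simp only [hi, indicator_of_notMem h]; simp
    simp only [e2] at hcheb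
    rw [e1, mul_comm, mul_assoc]
    gcongr
    exact (by gcongr : _ ≤ _).trans hcheb
  have hinner : ∀ ξ : ℝ, ∫⁻ t in Ioi (0 : ℝ), ENNReal.ofReal (4 * t) *
      {ξ : ℝ | |ξ| ≤ A t}ᶜ.indicator (fun ξ => ‖w ξ‖ₑ ^ 2) ξ ≤
      ENNReal.ofReal (64 * N ^ 2) * (ENNReal.ofReal (|ξ| ^ (1 / 2 : ℝ)) * ‖w ξ‖ₑ ^ 2) := by
    intro ξ
    -- The frequency `ξ` is high at level `t`, i.e. `A t < |ξ|`, only for `t < T`. Bounding `4t` by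
    -- `4T` on `(0, T)` gives `4T² = 64 N² |ξ|^{1/2}`.
    set T := 4 * N * √(√|ξ|) with hT
    have hT0 : 0 ≤ T := by positivity
    calc _ ≤ ∫⁻ t in Ioi (0 : ℝ), (Iio T).indicator
            (fun _ => ENNReal.ofReal (4 * T) * ‖w ξ‖ₑ ^ 2) t := by
          refine setLIntegral_mono (measurable_const.indicator measurableSet_Iio) fun t ht => ?_
          by_cases h : ξ ∈ {ξ : ℝ | |ξ| ≤ A t}ᶜ
          · have h' : A t < |ξ| := by simpa using h
            have e : |ξ| = (√(√|ξ|)) ^ 4 := by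
              rw [show (√(√|ξ|)) ^ 4 = ((√(√|ξ|)) ^ 2) ^ 2 by ring,
                Real.sq_sqrt (Real.sqrt_nonneg _), Real.sq_sqrt (abs_nonneg _)]
            have h3 : t / (4 * N) < √(√|ξ|) :=
              lt_of_pow_lt_pow_left₀ 4 (Real.sqrt_nonneg _) (by rw [← e]; exact h')
            have h4 : t < T := by
              rw [div_lt_iff₀ (by positivity)] at h3
              linarith
            rw [indicator_of_mem h, indicator_of_mem (show t ∈ Iio T from h4)]
            gcongr
          · rw [indicator_of_notMem h]
            simp
      _ = ENNReal.ofReal (4 * T) * ‖w ξ‖ₑ ^ 2 * ENNReal.ofReal T := by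
          rw [lintegral_indicator measurableSet_Iio, Measure.restrict_restrict measurableSet_Iio,
            setLIntegral_const, inter_comm, Ioi_inter_Iio, Real.volume_Ioo, sub_zero]
      _ = ENNReal.ofReal (64 * N ^ 2) * (ENNReal.ofReal (|ξ| ^ (1 / 2 : ℝ)) * ‖w ξ‖ₑ ^ 2) := by
          rw [mul_right_comm, ← ENNReal.ofReal_mul (by positivity),
            ← mul_assoc (ENNReal.ofReal (64 * N ^ 2)), ← ENNReal.ofReal_mul (by positivity)]
          congr 2
          rw [hT, ← Real.sqrt_eq_rpow]
          calc _ = 64 * N ^ 2 * (√(√|ξ|)) ^ 2 := by ring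
            _ = _ := by rw [Real.sq_sqrt (Real.sqrt_nonneg _)]
  have hmeas : Measurable (Function.uncurry fun t ξ : ℝ => ENNReal.ofReal (4 * t) *
      {ξ : ℝ | |ξ| ≤ A t}ᶜ.indicator (fun ξ => ‖w ξ‖ₑ ^ 2) ξ) := by
    have hs : MeasurableSet {p : ℝ × ℝ | |p.2| ≤ A p.1}ᶜ :=
      (measurableSet_le (by fun_prop) (by fun_prop)).compl
    have : Measurable fun p : ℝ × ℝ => ENNReal.ofReal (4 * p.1) *
        {p : ℝ × ℝ | |p.2| ≤ A p.1}ᶜ.indicator (fun p => ‖w p.2‖ₑ ^ 2) p :=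
      Measurable.mul (by fun_prop) (Measurable.indicator (by fun_prop) hs)
    exact this
  have hcake := lintegral_rpow_eq_lintegral_meas_lt_mul volume (f := fun x => ‖𝓕 w x‖)
    (ae_of_all _ fun x => norm_nonneg _) hu.norm.measurable.aemeasurable (p := 4) (by norm_num)
  have e4 : ∀ x, ENNReal.ofReal (‖𝓕 w x‖ ^ (4 : ℝ)) = ‖𝓕 w x‖ₑ ^ 4 := fun x => by
    rw [← ofReal_norm, ← ENNReal.ofReal_pow (norm_nonneg _)]
    norm_cast
  simp only [e4] at hcake
  rw [hcake]
  calc _ ≤ ENNReal.ofReal 4 * ∫⁻ t in Ioi (0 : ℝ), ∫⁻ ξ, ENNReal.ofReal (4 * t) *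
        {ξ : ℝ | |ξ| ≤ A t}ᶜ.indicator (fun ξ => ‖w ξ‖ₑ ^ 2) ξ := by
        gcongr ENNReal.ofReal 4 * ?_
        refine setLIntegral_mono (hmeas.lintegral_prod_right') fun t ht => (hlayer t ht).trans ?_
        rw [lintegral_const_mul _ (Measurable.indicator (by fun_prop) (hset t).compl)]
    _ = ENNReal.ofReal 4 * ∫⁻ ξ, ∫⁻ t in Ioi (0 : ℝ), ENNReal.ofReal (4 * t) *
        {ξ : ℝ | |ξ| ≤ A t}ᶜ.indicator (fun ξ => ‖w ξ‖ₑ ^ 2) ξ := by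
        rw [lintegral_lintegral_swap hmeas.aemeasurable]
    _ ≤ ENNReal.ofReal 4 * ∫⁻ ξ, ENNReal.ofReal (64 * N ^ 2) *
          (ENNReal.ofReal (|ξ| ^ (1 / 2 : ℝ)) * ‖w ξ‖ₑ ^ 2) := by
        gcongr with ξ
        exact hinner ξ
    _ = 256 * I ^ 2 := by
        rw [lintegral_const_mul _ (by fun_prop), ← hI, ENNReal.ofReal_mul (by norm_num), ← hIN,
          ← mul_assoc, ← mul_assoc, sq, ← mul_assoc, ← ENNReal.ofReal_mul (by norm_num)]
        norm_num

/-! ### Functions with a rapidly decaying spectrum -/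

/-- The real-valued function `u` is the Fourier transform of the rapidly decaying function `w`. -/
structure HasSpectrum (w : ℝ → ℂ) (u : ℝ → ℝ) : Prop where
  decay : RapidDecay w
  eq : ∀ x, (u x : ℂ) = 𝓕 w x

namespace HasSpectrum

variable {w : ℝ → ℂ} {u : ℝ → ℝ}

lemma eq_re (h : HasSpectrum w u) : u = fun x => (𝓕 w x).re := by
  ext x
  rw [← h.eq, Complex.ofReal_re]

lemma continuous (h : HasSpectrum w u) : Continuous u := by
  rw [h.eq_re]
  exact Complex.continuous_re.comp (continuous_fourier h.decay.integrable)

lemma exists_bound (h : HasSpectrum w u) : ∃ M, ∀ x, |u x| ≤ M := by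
  refine ⟨∫ ξ, ‖w ξ‖, fun x => ?_⟩
  rw [← Real.norm_eq_abs, ← Complex.norm_real, h.eq]
  exact norm_fourier_le x

lemma integrable_sq (h : HasSpectrum w u) : Integrable fun x => u x ^ 2 := by
  have h1 := (memLp_fourier h.decay.integrable h.decay.memLp_two)
  rw [memLp_two_iff_integrable_sq_norm h1.1] at h1
  refine h1.congr (ae_of_all _ fun x => ?_)
  simp only [← h.eq, Complex.norm_real, Real.norm_eq_abs, sq_abs]

/-- The complex function `𝓕 w` is real-valued, so its imaginary part is constant and the derivative
is real as well. -/
lemma hasDerivAt (h : HasSpectrum w u) (x : ℝ) :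
    HasDerivAt u (𝓕 (fun ξ : ℝ => (-2 * Real.pi * Complex.I * ξ) * w ξ) x).re x ∧
      (𝓕 (fun ξ : ℝ => (-2 * Real.pi * Complex.I * ξ) * w ξ) x).im = 0 := by
  have hw := h.decay
  have hi : Integrable fun ξ : ℝ => ξ • w ξ := by
    have := (hw.const_mul_id 1).integrable
    simpa using this
  have hd := Real.hasDerivAt_fourier hw.integrable hi x
  simp only [smul_eq_mul] at hd
  have hre := (Complex.reCLM.hasFDerivAt).comp_hasDerivAt x hd
  have him := (Complex.imCLM.hasFDerivAt).comp_hasDerivAt x hd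
  refine ⟨?_, ?_⟩
  · rw [h.eq_re]
    exact hre
  · have h0 : (Complex.imCLM ∘ 𝓕 w) = fun _ => 0 := by
      ext y
      simp [← h.eq]
    rw [h0] at him
    exact him.unique (hasDerivAt_const x 0)

lemma differentiable (h : HasSpectrum w u) : Differentiable ℝ u :=
  fun x => (h.hasDerivAt x).1.differentiableAt

protected lemma deriv (h : HasSpectrum w u) :
    HasSpectrum (fun ξ : ℝ => (-2 * Real.pi * Complex.I * ξ) * w ξ) (deriv u) := by
  refine ⟨h.decay.const_mul_id _, fun x => ?_⟩
  obtain ⟨h1, h2⟩ := h.hasDerivAt x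
  rw [h1.deriv]
  apply Complex.ext
  · rw [Complex.ofReal_re]
  · rw [Complex.ofReal_im, h2]

end HasSpectrum

/-! ### Finite differences on the Fourier side -/

/-- The symbol of the translation by `α`. -/
def shiftSymbol (α ξ : ℝ) : ℂ := Complex.exp (Complex.I * ((2 * Real.pi * (α * ξ) : ℝ) : ℂ))

lemma norm_shiftSymbol (α ξ : ℝ) : ‖shiftSymbol α ξ‖ = 1 := Complex.norm_exp_I_mul_ofReal _

lemma measurable_shiftSymbol : Measurable (Function.uncurry shiftSymbol) := by
  unfold shiftSymbol Function.uncurry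
  fun_prop

lemma fourier_shift (w : ℝ → ℂ) (α x : ℝ) :
    𝓕 (fun ξ => shiftSymbol α ξ * w ξ) x = 𝓕 w (x - α) := by
  rw [Real.fourier_real_eq_integral_exp_smul, Real.fourier_real_eq_integral_exp_smul]
  congr 1
  ext ξ
  rw [shiftSymbol, smul_eq_mul, smul_eq_mul, ← mul_assoc, ← Complex.exp_add]
  congr 2
  push_cast
  ring

/-- The symbol of `u ↦ (u - u(· - α)) / α`. -/
def slopeSymbol (α ξ : ℝ) : ℂ := (α : ℂ)⁻¹ * (1 - shiftSymbol α ξ)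

/-- The symbol of `u ↦ (Δ_α u - u') / α`. -/
def slopeErrorSymbol (α ξ : ℝ) : ℂ :=
  (α : ℂ)⁻¹ * (slopeSymbol α ξ - (-2 * Real.pi * Complex.I * ξ))

lemma measurable_slopeSymbol : Measurable (Function.uncurry slopeSymbol) := by
  unfold slopeSymbol Function.uncurry
  have : Measurable fun p : ℝ × ℝ => shiftSymbol p.1 p.2 := measurable_shiftSymbol
  fun_prop

lemma measurable_slopeErrorSymbol : Measurable (Function.uncurry slopeErrorSymbol) := by
  unfold slopeErrorSymbol Function.uncurry
  have : Measurable fun p : ℝ × ℝ => slopeSymbol p.1 p.2 := measurable_slopeSymbol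
  fun_prop

lemma RapidDecay.slopeSymbol_mul {w : ℝ → ℂ} (hw : RapidDecay w) (α : ℝ) :
    RapidDecay fun ξ => slopeSymbol α ξ * w ξ := by
  refine hw.mul_of_le (measurable_slopeSymbol.of_uncurry_left) 0 (‖(α : ℂ)⁻¹‖)
    fun ξ => ?_
  rw [slopeSymbol, norm_mul]
  refine mul_le_mul_of_nonneg_left ?_ (norm_nonneg _)
  refine (norm_sub_le _ _).trans ?_
  rw [norm_shiftSymbol]
  norm_num

lemma RapidDecay.slopeErrorSymbol_mul {w : ℝ → ℂ} (hw : RapidDecay w) (α : ℝ) :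
    RapidDecay fun ξ => slopeErrorSymbol α ξ * w ξ := by
  refine hw.mul_of_le (measurable_slopeErrorSymbol.of_uncurry_left) 1
    (‖(α : ℂ)⁻¹‖ * (‖(α : ℂ)⁻¹‖ * 2 + 2 * Real.pi)) fun ξ => ?_
  rw [slopeErrorSymbol, norm_mul, mul_assoc ‖(α : ℂ)⁻¹‖]
  refine mul_le_mul_of_nonneg_left ?_ (norm_nonneg _)
  refine (norm_sub_le _ _).trans ?_
  have h1 : ‖slopeSymbol α ξ‖ ≤ ‖(α : ℂ)⁻¹‖ * 2 := by
    rw [slopeSymbol, norm_mul]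
    gcongr
    refine (norm_sub_le _ _).trans ?_
    rw [norm_shiftSymbol, norm_one]
    norm_num
  have h2 : ‖(-2 * Real.pi * Complex.I * ξ : ℂ)‖ = 2 * Real.pi * |ξ| := by
    simp [abs_of_pos Real.pi_pos]
  rw [h2, pow_one]
  have h3 : 0 ≤ |ξ| := abs_nonneg ξ
  have h4 := Real.pi_pos
  have h5 : 0 ≤ ‖(α : ℂ)⁻¹‖ := norm_nonneg _
  nlinarith [mul_nonneg h5 h3]

protected lemma HasSpectrum.slope {w : ℝ → ℂ} {u : ℝ → ℝ} (h : HasSpectrum w u) (α : ℝ) :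
    HasSpectrum (fun ξ => slopeSymbol α ξ * w ξ) (slope α u) := by
  refine ⟨h.decay.slopeSymbol_mul α, fun x => ?_⟩
  have hs : RapidDecay fun ξ => shiftSymbol α ξ * w ξ :=
    h.decay.mul_of_le (measurable_shiftSymbol.of_uncurry_left) 0 1
      fun ξ => by rw [norm_shiftSymbol]; norm_num
  have e : (fun ξ => slopeSymbol α ξ * w ξ) =
      (α : ℂ)⁻¹ • (w - fun ξ => shiftSymbol α ξ * w ξ) := by
    ext ξ
    simp only [slopeSymbol, Pi.smul_apply, Pi.sub_apply, smul_eq_mul]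
    ring
  rw [Muskat.slope, e, fourier_const_smul, fourier_sub h.decay.integrable hs.integrable]
  simp only [Pi.smul_apply, Pi.sub_apply, smul_eq_mul, fourier_shift, ← h.eq]
  push_cast
  ring

/-- The normalised error `(Δ_α u(x) - u'(x)) / α`. -/
def slopeError (α : ℝ) (u : ℝ → ℝ) (x : ℝ) : ℝ := (slope α u x - deriv u x) / α

protected lemma HasSpectrum.slopeError {w : ℝ → ℂ} {u : ℝ → ℝ} (h : HasSpectrum w u) (α : ℝ) :
    HasSpectrum (fun ξ => slopeErrorSymbol α ξ * w ξ) (slopeError α u) := by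
  refine ⟨h.decay.slopeErrorSymbol_mul α, fun x => ?_⟩
  have e : (fun ξ => slopeErrorSymbol α ξ * w ξ) =
      (α : ℂ)⁻¹ • ((fun ξ => slopeSymbol α ξ * w ξ) -
        fun ξ : ℝ => (-2 * Real.pi * Complex.I * ξ) * w ξ) := by
    ext ξ
    simp only [slopeErrorSymbol, Pi.smul_apply, Pi.sub_apply, smul_eq_mul]
    ring
  rw [Muskat.slopeError, e, fourier_const_smul, fourier_sub (h.slope α).decay.integrable
    h.deriv.decay.integrable]
  simp only [Pi.smul_apply, Pi.sub_apply, smul_eq_mul, ← (h.slope α).eq, ← h.deriv.eq]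
  push_cast
  ring

/-- Follows from `|1 - e^{iθ}| ≤ min(|θ|, 2)` with `θ = 2παξ`. The factor `1` plays the role of `B
ξ` in the square function estimate. At `α = 0` both sides vanish, by the convention for division by
zero. -/
lemma norm_slopeSymbol_sq_le (α ξ : ℝ) :
    ‖slopeSymbol α ξ‖ ^ 2 ≤ 1 * min ((2 * Real.pi * |ξ|) ^ 2) (4 / α ^ 2) := by
  rw [one_mul]
  rcases eq_or_ne α 0 with rfl | hα
  · simp [slopeSymbol, sq_nonneg]
  have hα' : 0 < |α| := abs_pos.2 hα
  have e : ‖slopeSymbol α ξ‖ = ‖1 - shiftSymbol α ξ‖ / |α| := by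
    rw [slopeSymbol, norm_mul, norm_inv, Complex.norm_real, Real.norm_eq_abs]
    ring
  have h1 : ‖1 - shiftSymbol α ξ‖ ≤ 2 * Real.pi * |ξ| * |α| := by
    rw [norm_sub_rev]
    refine (Real.norm_exp_I_mul_ofReal_sub_one_le).trans (le_of_eq ?_)
    rw [Real.norm_eq_abs, abs_mul, abs_of_pos Real.two_pi_pos, abs_mul]
    ring
  have h2 : ‖1 - shiftSymbol α ξ‖ ≤ 2 := by
    refine (norm_sub_le _ _).trans ?_
    rw [norm_shiftSymbol, norm_one]
    norm_num
  rw [e, le_min_iff]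
  constructor
  · gcongr
    rwa [div_le_iff₀ hα']
  · rw [div_pow, sq_abs, show (4 : ℝ) = 2 ^ 2 by norm_num]
    gcongr

/-- Second-order Taylor bound for `|θ| ≤ 1`, triangle inequality for `|θ| ≥ 1`. -/
lemma norm_exp_I_sub_one_sub_le (θ : ℝ) :
    ‖Complex.exp (Complex.I * θ) - 1 - Complex.I * θ‖ ≤ 2 * |θ| * min |θ| 1 := by
  have hI : ‖Complex.I * (θ : ℂ)‖ = |θ| := by simp
  rcases le_total |θ| 1 with h | h
  · rw [min_eq_left h]
    refine (Complex.norm_exp_sub_one_sub_id_le (by rwa [hI])).trans ?_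
    rw [hI]
    nlinarith [abs_nonneg θ]
  · rw [min_eq_right h]
    refine (norm_sub_le _ _).trans ?_
    have := Real.norm_exp_I_mul_ofReal_sub_one_le (x := θ)
    rw [hI]
    rw [Real.norm_eq_abs] at this
    linarith

/-- The symbol is `-(e^{iθ} - 1 - iθ)/α²` with `θ = 2παξ`. Compared with the slope symbol it costs
one more factor `2b`, where `b = 2π|ξ|`, and keeps the same integrable profile in `α`. -/
lemma norm_slopeErrorSymbol_sq_le (α ξ : ℝ) :
    ‖slopeErrorSymbol α ξ‖ ^ 2 ≤
      (4 * (2 * Real.pi * |ξ|) ^ 2) * min ((2 * Real.pi * |ξ|) ^ 2) (4 / α ^ 2) := by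
  rcases eq_or_ne α 0 with rfl | hα
  · simp only [slopeErrorSymbol, Complex.ofReal_zero, inv_zero, zero_mul, norm_zero]
    rw [zero_pow two_ne_zero]
    positivity
  have hα' : 0 < |α| := abs_pos.2 hα
  set b := 2 * Real.pi * |ξ| with hb
  have hb0 : 0 ≤ b := by positivity
  have hθ : |2 * Real.pi * (α * ξ)| = b * |α| := by
    rw [abs_mul, abs_of_pos Real.two_pi_pos, abs_mul, hb]
    ring
  have e : slopeErrorSymbol α ξ = -((α : ℂ) ^ 2)⁻¹ *
      (Complex.exp (Complex.I * ((2 * Real.pi * (α * ξ) : ℝ) : ℂ)) - 1 -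
        Complex.I * ((2 * Real.pi * (α * ξ) : ℝ) : ℂ)) := by
    have : (α : ℂ) ≠ 0 := by exact_mod_cast hα
    rw [slopeErrorSymbol, slopeSymbol, shiftSymbol]
    field_simp
    push_cast
    ring
  have h1 : ‖slopeErrorSymbol α ξ‖ ≤ 2 * b * min b (2 / |α|) := by
    rw [e, norm_mul, norm_neg, norm_inv, norm_pow, Complex.norm_real, Real.norm_eq_abs]
    have h := norm_exp_I_sub_one_sub_le (2 * Real.pi * (α * ξ))
    rw [hθ] at h
    calc _ ≤ (|α| ^ 2)⁻¹ * (2 * (b * |α|) * min (b * |α|) 1) := by gcongr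
      _ = 2 * b * (min (b * |α|) 1 / |α|) := by field_simp
      _ ≤ 2 * b * min b (2 / |α|) := by
          gcongr
          rw [le_min_iff]
          constructor
          · rw [div_le_iff₀ hα']
            exact min_le_left _ _
          · gcongr
            exact (min_le_right _ _).trans (by norm_num)
  have h2 : (min b (2 / |α|)) ^ 2 ≤ min (b ^ 2) (4 / α ^ 2) := by
    have h0 : 0 ≤ min b (2 / |α|) := le_min hb0 (by positivity)
    rw [le_min_iff]
    constructor
    · gcongr
      exact min_le_left _ _
    · rw [← sq_abs α, show (4 : ℝ) = 2 ^ 2 by norm_num, ← div_pow]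
      gcongr
      exact min_le_right _ _
  calc _ ≤ (2 * b * min b (2 / |α|)) ^ 2 := by gcongr
    _ = 4 * b ^ 2 * (min b (2 / |α|)) ^ 2 := by ring
    _ ≤ _ := by gcongr

/-- The square function estimate: the `L⁴` norms of a family of Fourier multipliers which are
bounded like difference quotients are square integrable in the parameter. -/
lemma lintegral_sqrt_lintegral_fourier_le {w : ℝ → ℂ} (hw : Measurable w) {q : ℝ → ℝ → ℂ}
    (hq : Measurable fun p : ℝ × ℝ => q p.1 p.2) (hqw : ∀ α, RapidDecay fun ξ => q α ξ * w ξ)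
    {B : ℝ → ℝ} (hB : Measurable B) (hB0 : ∀ ξ, 0 ≤ B ξ)
    (hle : ∀ α ξ, ‖q α ξ‖ ^ 2 ≤ B ξ * min ((2 * Real.pi * |ξ|) ^ 2) (4 / α ^ 2)) :
    ∫⁻ α, (∫⁻ x, ‖𝓕 (fun ξ => q α ξ * w ξ) x‖ₑ ^ 4) ^ (1 / 2 : ℝ) ≤
      ∫⁻ ξ, ENNReal.ofReal (320 * Real.pi * |ξ| ^ (3 / 2 : ℝ) * B ξ) * ‖w ξ‖ₑ ^ 2 := by
  have h1 : ∀ α, (∫⁻ x, ‖𝓕 (fun ξ => q α ξ * w ξ) x‖ₑ ^ 4) ^ (1 / 2 : ℝ) ≤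
      16 * ∫⁻ ξ, ENNReal.ofReal (|ξ| ^ (1 / 2 : ℝ)) * ‖q α ξ * w ξ‖ₑ ^ 2 := fun α => by
    refine (ENNReal.rpow_le_rpow (hqw α).lintegral_fourier_pow_four_le (by norm_num)).trans
      (le_of_eq ?_)
    -- The square root of the Sobolev constant `256`; with the `10 · 2π|ξ|` from the `α`-integral it
    -- makes up `320π`.
    rw [show (256 : ℝ≥0∞) = 16 ^ 2 by norm_num, ← mul_pow, ← ENNReal.rpow_natCast,
      ← ENNReal.rpow_mul]
    norm_num
  have hm : Measurable fun p : ℝ × ℝ =>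
      ENNReal.ofReal (|p.2| ^ (1 / 2 : ℝ)) * ‖q p.1 p.2 * w p.2‖ₑ ^ 2 := by fun_prop
  calc _ ≤ ∫⁻ α, 16 * ∫⁻ ξ, ENNReal.ofReal (|ξ| ^ (1 / 2 : ℝ)) * ‖q α ξ * w ξ‖ₑ ^ 2 :=
        lintegral_mono h1
    _ = 16 * ∫⁻ ξ, ∫⁻ α, ENNReal.ofReal (|ξ| ^ (1 / 2 : ℝ)) * ‖q α ξ * w ξ‖ₑ ^ 2 := by
        rw [lintegral_const_mul _ hm.lintegral_prod_right', lintegral_lintegral_swap]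
        exact hm.aemeasurable
    _ ≤ 16 * ∫⁻ ξ, ENNReal.ofReal (20 * Real.pi * |ξ| ^ (3 / 2 : ℝ) * B ξ) * ‖w ξ‖ₑ ^ 2 := by
        gcongr with ξ
        calc _ ≤ ∫⁻ α, (ENNReal.ofReal (|ξ| ^ (1 / 2 : ℝ) * B ξ) * ‖w ξ‖ₑ ^ 2) *
              ENNReal.ofReal (min ((2 * Real.pi * |ξ|) ^ 2) (4 / α ^ 2)) := by
              refine lintegral_mono fun α => ?_
              have hq2 : ‖q α ξ‖ₑ ^ 2 ≤ ENNReal.ofReal (B ξ) *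
                  ENNReal.ofReal (min ((2 * Real.pi * |ξ|) ^ 2) (4 / α ^ 2)) := by
                rw [← ENNReal.ofReal_mul (hB0 ξ), ← ofReal_norm,
                  ← ENNReal.ofReal_pow (norm_nonneg _)]
                exact ENNReal.ofReal_le_ofReal (hle α ξ)
              rw [enorm_mul, mul_pow, ENNReal.ofReal_mul (by positivity)]
              calc _ ≤ ENNReal.ofReal (|ξ| ^ (1 / 2 : ℝ)) * ((ENNReal.ofReal (B ξ) *
                    ENNReal.ofReal (min ((2 * Real.pi * |ξ|) ^ 2) (4 / α ^ 2))) *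
                    ‖w ξ‖ₑ ^ 2) := by gcongr
                _ = _ := by ring
          _ ≤ (ENNReal.ofReal (|ξ| ^ (1 / 2 : ℝ) * B ξ) * ‖w ξ‖ₑ ^ 2) *
              ENNReal.ofReal (10 * (2 * Real.pi * |ξ|)) := by
              rw [lintegral_const_mul _ (by fun_prop)]
              gcongr
              exact lintegral_min_sq_le _ (by positivity)
          _ = _ := by
              have := hB0 ξ
              rw [mul_right_comm, ← ENNReal.ofReal_mul (by positivity)]
              congr 2
              rw [show (3 / 2 : ℝ) = 1 / 2 + 1 by norm_num,
                Real.rpow_add' (abs_nonneg ξ) (by norm_num), Real.rpow_one]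
              ring
    _ = _ := by
        rw [← lintegral_const_mul _ (by fun_prop)]
        refine lintegral_congr fun ξ => ?_
        have := hB0 ξ
        rw [← mul_assoc, show (16 : ℝ≥0∞) = ENNReal.ofReal 16 by simp,
          ← ENNReal.ofReal_mul (by norm_num)]
        congr 2
        ring

lemma HasSpectrum.lintegral_slope_le {w : ℝ → ℂ} {u : ℝ → ℝ} (h : HasSpectrum w u) :
    ∫⁻ α, (∫⁻ x, ‖slope α u x‖ₑ ^ 4) ^ (1 / 2 : ℝ) ≤
      ∫⁻ ξ, ENNReal.ofReal (320 * Real.pi * |ξ| ^ (3 / 2 : ℝ)) * ‖w ξ‖ₑ ^ 2 := by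
  have := lintegral_sqrt_lintegral_fourier_le h.decay.measurable measurable_slopeSymbol
    h.decay.slopeSymbol_mul (B := fun _ => 1) (by fun_prop) (by simp) norm_slopeSymbol_sq_le
  simpa only [mul_one, ← (h.slope _).eq, ← ofReal_norm, Complex.norm_real] using this

lemma HasSpectrum.lintegral_slopeError_le {w : ℝ → ℂ} {u : ℝ → ℝ} (h : HasSpectrum w u) :
    ∫⁻ α, (∫⁻ x, ‖Muskat.slopeError α u x‖ₑ ^ 4) ^ (1 / 2 : ℝ) ≤
      ∫⁻ ξ, ENNReal.ofReal (320 * Real.pi * |ξ| ^ (3 / 2 : ℝ) * (4 * (2 * Real.pi * |ξ|) ^ 2)) *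
        ‖w ξ‖ₑ ^ 2 := by
  have := lintegral_sqrt_lintegral_fourier_le h.decay.measurable measurable_slopeErrorSymbol
    h.decay.slopeErrorSymbol_mul (B := fun ξ => 4 * (2 * Real.pi * |ξ|) ^ 2) (by fun_prop)
    (fun ξ => by positivity) norm_slopeErrorSymbol_sq_le
  simpa only [← (h.slopeError _).eq, ← ofReal_norm, Complex.norm_real] using this

/-! ### The nonlinearity and pointwise bounds on slopes -/

lemma hasDerivAt_F (y : ℝ) : HasDerivAt F (2 * y / (1 + y ^ 2) ^ 2) y := by
  have h0 : 1 + y ^ 2 ≠ 0 := by positivity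
  have h := ((hasDerivAt_id y).pow 2).div (((hasDerivAt_id y).pow 2).const_add 1) h0
  refine h.congr_deriv ?_
  simp
  ring

lemma abs_deriv_F_le (y : ℝ) : |2 * y / (1 + y ^ 2) ^ 2| ≤ 1 := by
  rw [abs_div, abs_of_pos (by positivity : (0 : ℝ) < (1 + y ^ 2) ^ 2), div_le_one (by positivity),
    abs_mul, abs_two]
  have h1 : 2 * |y| ≤ 1 + y ^ 2 := by
    have := sq_nonneg (1 - |y|)
    have := sq_abs y
    nlinarith
  nlinarith [sq_nonneg y, sq_nonneg (y ^ 2)]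

lemma abs_F_sub_le (y z : ℝ) : |F y - F z| ≤ |y - z| := by
  have h := Convex.norm_image_sub_le_of_norm_hasDerivWithin_le (f := F) (s := univ) (C := 1)
    (fun x _ => (hasDerivAt_F x).hasDerivWithinAt) (fun x _ => abs_deriv_F_le x) convex_univ
    (mem_univ z) (mem_univ y)
  simpa using h

lemma continuous_F : Continuous F :=
  continuous_iff_continuousAt.2 fun y => (hasDerivAt_F y).continuousAt

/-- The mean value theorem for slopes. -/
lemma exists_slope_eq_deriv {u : ℝ → ℝ} (hu : Differentiable ℝ u) {α : ℝ} (hα : α ≠ 0) (x : ℝ) :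
    ∃ c, |c - x| ≤ |α| ∧ |c - (x - α)| ≤ |α| ∧ slope α u x = deriv u c := by
  rcases lt_or_gt_of_ne hα with h | h
  · obtain ⟨c, hc, he⟩ := exists_deriv_eq_slope u (show x < x - α by linarith)
      hu.continuous.continuousOn hu.differentiableOn
    refine ⟨c, ?_, ?_, ?_⟩
    · rw [abs_of_neg h, abs_of_pos (by linarith [hc.1])]; linarith [hc.2]
    · rw [abs_of_neg h, abs_of_neg (by linarith [hc.2])]; linarith [hc.1]
    · rw [he, slope]
      rw [show x - α - x = -α by ring, ← neg_sub (u x), neg_div_neg_eq]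
  · obtain ⟨c, hc, he⟩ := exists_deriv_eq_slope u (show x - α < x by linarith)
      hu.continuous.continuousOn hu.differentiableOn
    refine ⟨c, ?_, ?_, ?_⟩
    · rw [abs_of_pos h, abs_of_neg (by linarith [hc.2])]; linarith [hc.1]
    · rw [abs_of_pos h, abs_of_pos (by linarith [hc.1])]; linarith [hc.2]
    · rw [he, slope]
      rw [show x - (x - α) = α by ring]

/-! ### Difference quotients of functions with bounded derivatives -/

/-- The decay rate `min(1, |α|⁻¹)` of difference quotients. -/
def decayRate (α : ℝ) : ℝ := min 1 |α|⁻¹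

lemma decayRate_nonneg (α : ℝ) : 0 ≤ decayRate α := le_min zero_le_one (by positivity)

lemma decayRate_neg (α : ℝ) : decayRate (-α) = decayRate α := by rw [decayRate, abs_neg, decayRate]

lemma decayRate_sq_le (α : ℝ) : decayRate α ^ 2 ≤ 2 * (1 + α ^ 2)⁻¹ := by
  have h0 := decayRate_nonneg α
  have h1 : decayRate α ≤ 1 := min_le_left _ _
  have h2 : decayRate α * |α| ≤ 1 := by
    rcases eq_or_ne α 0 with rfl | hα
    · simp
    calc _ ≤ |α|⁻¹ * |α| := by gcongr; exact min_le_right _ _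
      _ = 1 := inv_mul_cancel₀ (abs_ne_zero.2 hα)
  rw [← div_eq_mul_inv, le_div_iff₀ (by positivity), ← sq_abs α]
  have h3 : (decayRate α * |α|) ^ 2 ≤ 1 := pow_le_one₀ (by positivity) h2
  have h4 : decayRate α ^ 2 ≤ 1 := pow_le_one₀ h0 h1
  nlinarith

lemma integrable_decayRate_sq : Integrable fun α => decayRate α ^ 2 :=
  (integrable_inv_one_add_sq.const_mul 2).mono'
    (by unfold decayRate; fun_prop) (ae_of_all _ fun α => by
      rw [Real.norm_of_nonneg (by positivity)]; exact decayRate_sq_le α)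

lemma abs_div_le_decayRate {y α C : ℝ} (hC : 0 ≤ C) (h1 : |y| ≤ C * |α|) (h2 : |y| ≤ C) :
    |y / α| ≤ C * decayRate α := by
  rcases eq_or_ne α 0 with rfl | hα
  · simpa using mul_nonneg hC (decayRate_nonneg 0)
  have hα' : 0 < |α| := abs_pos.2 hα
  rw [decayRate, mul_min_of_nonneg _ _ hC, abs_div, le_min_iff, mul_one]
  refine ⟨(div_le_iff₀ hα').2 h1, ?_⟩
  rw [div_eq_mul_inv]
  gcongr

/-- A function that is bounded together with its first two derivatives, whose derivative is
continuous and square integrable. -/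
structure Tame (u : ℝ → ℝ) (M : ℝ) : Prop where
  differentiable : Differentiable ℝ u
  continuous_deriv : Continuous (deriv u)
  nonneg : 0 ≤ M
  bounded : ∀ x, |u x| ≤ M
  abs_deriv_le : ∀ x, |deriv u x| ≤ M
  lipschitz : ∀ x y, |deriv u x - deriv u y| ≤ M * |x - y|
  integrable_sq : Integrable fun x => deriv u x ^ 2

/-- The functions `u`, `u'`, `u''` all have rapidly decaying spectra, hence are bounded; the mean
value inequality turns the bound on `u''` into the Lipschitz bound. -/
lemma HasSpectrum.exists_tame {w : ℝ → ℂ} {u : ℝ → ℝ} (h : HasSpectrum w u) : ∃ M, Tame u M := by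
  obtain ⟨A, hA⟩ := h.exists_bound
  obtain ⟨B, hB⟩ := h.deriv.exists_bound
  obtain ⟨C, hC⟩ := h.deriv.deriv.exists_bound
  have hA0 : 0 ≤ A := (abs_nonneg _).trans (hA 0)
  have hB0 : 0 ≤ B := (abs_nonneg _).trans (hB 0)
  have hC0 : 0 ≤ C := (abs_nonneg _).trans (hC 0)
  refine ⟨A + B + C, h.differentiable, h.deriv.continuous, by positivity,
    fun x => (hA x).trans (by linarith), fun x => (hB x).trans (by linarith), fun x y => ?_,
    h.deriv.integrable_sq⟩
  have := Convex.norm_image_sub_le_of_norm_deriv_le (f := deriv u) (s := univ) (C := C)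
    (fun x _ => h.deriv.differentiable x) (fun x _ => hC x) convex_univ (mem_univ y) (mem_univ x)
  refine this.trans ?_
  rw [Real.norm_eq_abs]
  gcongr
  linarith

namespace Tame

variable {u : ℝ → ℝ} {M : ℝ}

lemma abs_slope_sub_deriv_le (h : Tame u M) {α : ℝ} (hα : α ≠ 0) (x : ℝ) :
    |slope α u x - deriv u x| ≤ 2 * M * |α| ∧ |slope α u x - deriv u x| ≤ 2 * M := by
  obtain ⟨c, h1, -, he⟩ := exists_slope_eq_deriv h.differentiable hα x
  have hM := h.nonneg
  rw [he]
  constructor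
  · have := h.lipschitz c x
    nlinarith [mul_le_mul_of_nonneg_left h1 hM, mul_nonneg hM (abs_nonneg α)]
  · refine (abs_sub _ _).trans ?_
    linarith [h.abs_deriv_le c, h.abs_deriv_le x]

lemma abs_deriv_sub_slope_le (h : Tame u M) {α : ℝ} (hα : α ≠ 0) (x : ℝ) :
    |deriv u (x - α) - slope α u x| ≤ 2 * M * |α| ∧
      |deriv u (x - α) - slope α u x| ≤ 2 * M := by
  obtain ⟨c, -, h1, he⟩ := exists_slope_eq_deriv h.differentiable hα x
  have hM := h.nonneg
  rw [he, abs_sub_comm]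
  constructor
  · have := h.lipschitz c (x - α)
    nlinarith [mul_le_mul_of_nonneg_left h1 hM, mul_nonneg hM (abs_nonneg α)]
  · refine (abs_sub _ _).trans ?_
    linarith [h.abs_deriv_le c, h.abs_deriv_le (x - α)]

lemma abs_sub_le (h : Tame u M) (α x : ℝ) :
    |u x - u (x - α)| ≤ 2 * M * |α| ∧ |u x - u (x - α)| ≤ 2 * M := by
  have hM := h.nonneg
  constructor
  · have := Convex.norm_image_sub_le_of_norm_deriv_le (f := u) (s := univ) (C := M)
      (fun x _ => h.differentiable x) (fun x _ => h.abs_deriv_le x) convex_univ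
      (mem_univ (x - α)) (mem_univ x)
    rw [Real.norm_eq_abs, Real.norm_eq_abs, sub_sub_cancel] at this
    nlinarith [mul_nonneg hM (abs_nonneg α)]
  · refine (abs_sub _ _).trans ?_
    linarith [h.bounded x, h.bounded (x - α)]

lemma abs_slope_le (h : Tame u M) (α x : ℝ) : |slope α u x| ≤ 2 * M * decayRate α :=
  abs_div_le_decayRate (by linarith [h.nonneg]) (h.abs_sub_le α x).1 (h.abs_sub_le α x).2

end Tame

/-- The increment `F(Δ_α f(x)) - F(f'(x))`. -/
def increment (f : ℝ → ℝ) (x α : ℝ) : ℝ := F (slope α f x) - F (deriv f x)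

variable {f g : ℝ → ℝ} {M N : ℝ}

/-- For small `α` the increment is `O(|α|)` because `F` and `f'` are Lipschitz; for large `α` it is
merely bounded. -/
lemma Tame.abs_increment_div_le (hf : Tame f M) (x α : ℝ) :
    |increment f x α / α| ≤ 2 * M * decayRate α := by
  rcases eq_or_ne α 0 with rfl | hα
  · simpa using mul_nonneg (mul_nonneg zero_le_two hf.nonneg) (decayRate_nonneg 0)
  obtain ⟨h1, h2⟩ := hf.abs_slope_sub_deriv_le hα x
  have h3 := abs_F_sub_le (slope α f x) (deriv f x)
  exact abs_div_le_decayRate (by linarith [hf.nonneg]) (h3.trans h1) (h3.trans h2)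

lemma Tame.measurable_increment (hf : Tame f M) :
    Measurable (Function.uncurry (increment f)) := by
  have h1 : Measurable f := hf.differentiable.continuous.measurable
  have h2 : Measurable (deriv f) := hf.continuous_deriv.measurable
  have h3 : Measurable F := continuous_F.measurable
  unfold increment slope Function.uncurry
  fun_prop

lemma evenPart_sub_eq (f : ℝ → ℝ) (x α : ℝ) :
    evenPart f α x - F (deriv f x) = (increment f x α + increment f x (-α)) / 2 := by
  rw [evenPart, increment, increment]
  ring

lemma oddPart_eq (f : ℝ → ℝ) (x α : ℝ) :
    oddPart f α x = (increment f x α - increment f x (-α)) / 2 := by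
  rw [oddPart, increment, increment]
  ring

/-- Both `g'` and the decay rate lie in `L²`, so the product is integrable. -/
lemma Tame.integrable_deriv_mul (hg : Tame g N) (x : ℝ) {b : ℝ → ℝ} (hb : Measurable b) {C : ℝ}
    (hbC : ∀ α, |b α| ≤ C * decayRate α) : Integrable fun α => deriv g (x - α) * b α := by
  have h1 : Integrable fun α => deriv g (x - α) ^ 2 := hg.integrable_sq.comp_sub_left x
  have h2 : Measurable (deriv g) := hg.continuous_deriv.measurable
  refine (h1.add (integrable_decayRate_sq.const_mul (C ^ 2))).mono' (by fun_prop)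
    (ae_of_all _ fun α => ?_)
  have h3 : b α ^ 2 ≤ (C * decayRate α) ^ 2 := by
    rw [← sq_abs]
    gcongr
    exact hbC α
  rw [Real.norm_eq_abs, abs_mul]
  change _ ≤ deriv g (x - α) ^ 2 + C ^ 2 * decayRate α ^ 2
  rw [← sq_abs (deriv g (x - α))]
  rw [← sq_abs (b α)] at h3
  nlinarith [sq_nonneg (|deriv g (x - α)| - |b α|), sq_nonneg |deriv g (x - α)|, sq_nonneg |b α|]

/-! ### Existence of the remainder -/

lemma integrandO_eq (x : ℝ) : integrandO f g x =
    fun α => deriv g (x - α) * ((increment f x α / α + increment f x (-α) / (-α)) / 2) := by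
  ext α
  rw [integrandO, oddPart_eq, div_neg]
  ring

/-- Isolates the only part that is not absolutely integrable in general: the term with `g'(x)`,
whose kernel is odd in `α` and of order `1/α` at infinity. -/
lemma integrandE_eq (hg : Tame g N) (x : ℝ) : integrandE f g x =
    fun α => deriv g x * ((increment f x α / α - increment f x (-α) / (-α)) / 2) -
      deriv g (x - α) * ((increment f x α / α - increment f x (-α) / (-α)) / 2) := by
  ext α
  have hd : deriv (slope α g) x = (deriv g x - deriv g (x - α)) / α := by
    have h1 : HasDerivAt (fun y => g (y - α)) (deriv g (x - α)) x :=
      (hg.differentiable (x - α)).hasDerivAt.comp_sub_const x α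
    exact (((hg.differentiable x).hasDerivAt.sub h1).div_const α).deriv
  rw [integrandE, evenPart_sub_eq, hd, div_neg]
  ring

lemma Tame.abs_half_increments_le (hf : Tame f M) (x α : ℝ) :
    |(increment f x α / α + increment f x (-α) / (-α)) / 2| ≤ 2 * M * decayRate α ∧
      |(increment f x α / α - increment f x (-α) / (-α)) / 2| ≤ 2 * M * decayRate α := by
  have h1 := hf.abs_increment_div_le x α
  have h2 := hf.abs_increment_div_le x (-α)
  rw [decayRate_neg] at h2
  rw [abs_le] at h1 h2
  constructor <;> rw [abs_le] <;> constructor <;> linarith [h1.1, h1.2, h2.1, h2.2]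

lemma Tame.measurable_half_increments (hf : Tame f M) (x : ℝ) :
    (Measurable fun α => (increment f x α / α + increment f x (-α) / (-α)) / 2) ∧
      Measurable fun α => (increment f x α / α - increment f x (-α) / (-α)) / 2 := by
  have h : Measurable (increment f x) :=
    hf.measurable_increment.of_uncurry_left
  constructor <;> fun_prop

lemma measurableSet_trunc (ε : ℝ) : MeasurableSet (trunc ε) := by
  have h1 : MeasurableSet {α : ℝ | ε < |α|} := measurableSet_lt (by fun_prop) (by fun_prop)
  have h2 : MeasurableSet {α : ℝ | |α| < ε⁻¹} := measurableSet_lt (by fun_prop) (by fun_prop)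
  exact h1.inter h2

lemma aecover_trunc : AECover (volume : Measure ℝ) (𝓝[>] (0 : ℝ)) trunc := by
  refine ⟨?_, fun ε => measurableSet_trunc ε⟩
  filter_upwards [Measure.ae_ne volume (0 : ℝ)] with α hα
  have hα' : 0 < |α| := abs_pos.2 hα
  filter_upwards [Ioo_mem_nhdsGT (show (0 : ℝ) < min |α| |α|⁻¹ by positivity)] with ε hε
  have h1 := hε.2.trans_le (min_le_left _ _)
  have h2 := hε.2.trans_le (min_le_right _ _)
  exact ⟨h1, (lt_inv_comm₀ hα' hε.1).2 h2⟩

lemma volume_trunc_lt_top {ε : ℝ} : volume (trunc ε) < ⊤ := by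
  refine (measure_mono (t := Ioo (-ε⁻¹) ε⁻¹) fun α hα => abs_lt.1 hα.2).trans_lt ?_
  rw [Real.volume_Ioo]
  exact ENNReal.ofReal_lt_top

lemma setIntegral_trunc_of_odd {h : ℝ → ℝ} (hh : ∀ α, h (-α) = -h α) (ε : ℝ) :
    ∫ α in trunc ε, h α = 0 := by
  rw [← integral_indicator (measurableSet_trunc ε)]
  have e : ∀ α, (trunc ε).indicator h (-α) = -(trunc ε).indicator h α := fun α => by
    have : -α ∈ trunc ε ↔ α ∈ trunc ε := by simp only [trunc, mem_ofPred_eq, abs_neg]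
    by_cases hα : α ∈ trunc ε
    · rw [indicator_of_mem hα, indicator_of_mem (this.2 hα), hh]
    · rw [indicator_of_notMem hα, indicator_of_notMem (fun h => hα (this.1 h)), neg_zero]
  have := integral_neg_eq_self ((trunc ε).indicator h) volume
  simp only [e, integral_neg] at this
  linarith

/-- The term with `g'(x)` integrates to zero over each symmetric truncation, and the other term
converges absolutely. -/
lemma hasPV_integrandE (hf : Tame f M) (hg : Tame g N) (x : ℝ) :
    HasPV (integrandE f g x) (-∫ α, deriv g (x - α) *
      ((increment f x α / α - increment f x (-α) / (-α)) / 2)) := by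
  have hb := fun α => (hf.abs_half_increments_le x α).2
  have hm := (hf.measurable_half_increments x).2
  set b := fun α => (increment f x α / α - increment f x (-α) / (-α)) / 2 with hbdef
  have hk : Integrable fun α => deriv g (x - α) * b α := hg.integrable_deriv_mul x hm hb
  have hbi : ∀ ε, IntegrableOn (fun α => deriv g x * b α) (trunc ε) := fun ε => by
    refine Integrable.const_mul (Measure.integrableOn_of_bounded volume_trunc_lt_top.ne
      hm.aestronglyMeasurable (M := 2 * M) (ae_of_all _ fun α => (hb α).trans ?_)) _
    have := hf.nonneg
    exact mul_le_of_le_one_right (by positivity) (min_le_left _ _)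
  rw [integrandE_eq hg]
  refine ⟨fun ε _ => (hbi ε).sub hk.integrableOn, ?_⟩
  have e : ∀ ε, ∫ α in trunc ε, (deriv g x * b α - deriv g (x - α) * b α) =
      -∫ α in trunc ε, deriv g (x - α) * b α := fun ε => by
    rw [integral_sub (hbi ε) hk.integrableOn, setIntegral_trunc_of_odd, zero_sub]
    intro α
    simp only [hbdef, neg_neg]
    ring
  simp only [hbdef] at e ⊢
  simp only [e]
  exact (aecover_trunc.integral_tendsto_of_countably_generated hk).neg

lemma remainderExists_of_tame (hf : Tame f M) (hg : Tame g N) : RemainderExists f g := by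
  refine ⟨hf.differentiable, hg.differentiable, fun x => ⟨_, hasPV_integrandE hf hg x⟩,
    fun x => ?_⟩
  rw [integrandO_eq]
  exact hg.integrable_deriv_mul x (hf.measurable_half_increments x).1
    fun α => (hf.abs_half_increments_le x α).1

lemma Tame.integrable_deriv_mul_increment (hf : Tame f M) (hg : Tame g N) (x : ℝ) :
    Integrable fun α => deriv g (x - α) * (increment f x α / α) := by
  refine hg.integrable_deriv_mul x ?_ (hf.abs_increment_div_le x)
  have : Measurable (increment f x) :=
    hf.measurable_increment.of_uncurry_left
  fun_prop

/-- The remainder as a single absolutely convergent integral. -/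
lemma remainder_eq (hf : Tame f M) (hg : Tame g N) (x : ℝ) : remainder f g x =
    (1 / Real.pi) * ∫ α, deriv g (x - α) * (increment f x α / α) := by
  have h1 : Integrable fun α => deriv g (x - α) *
      ((increment f x α / α - increment f x (-α) / (-α)) / 2) :=
    hg.integrable_deriv_mul x (hf.measurable_half_increments x).2
      fun α => (hf.abs_half_increments_le x α).2
  have h2 : Integrable fun α => deriv g (x - α) *
      ((increment f x α / α + increment f x (-α) / (-α)) / 2) :=
    hg.integrable_deriv_mul x (hf.measurable_half_increments x).1
      fun α => (hf.abs_half_increments_le x α).1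
  -- The two minus signs cancel, and the half-difference and half-sum of the quotients at `α` and
  -- `-α` add up to the quotient at `α`.
  rw [remainder, pv, (hasPV_integrandE hf hg x).2.limUnder_eq, integrandO_eq, neg_mul_neg,
    ← mul_add, ← integral_add h1 h2]
  congr 2
  ext α
  ring

/-! ### Integration by parts -/

/-- The integrand obtained by integrating by parts. -/
def partsIntegrand (f g : ℝ → ℝ) (x α : ℝ) : ℝ :=
  slope α g x * (2 * slope α f x / (1 + slope α f x ^ 2) ^ 2 *
    ((deriv f (x - α) - slope α f x) / α) - increment f x α / α)

lemma abs_partsIntegrand_le (f g : ℝ → ℝ) (x α : ℝ) :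
    |partsIntegrand f g x α| ≤
      |slope α g x| * (|(deriv f (x - α) - slope α f x) / α| + |slopeError α f x|) := by
  rw [partsIntegrand, abs_mul]
  gcongr
  refine (abs_sub _ _).trans (add_le_add ?_ ?_)
  · rw [abs_mul]
    exact mul_le_of_le_one_left (abs_nonneg _) (abs_deriv_F_le _)
  · rw [slopeError, increment, abs_div, abs_div]
    exact div_le_div_of_nonneg_right (abs_F_sub_le _ _) (abs_nonneg α)

lemma Tame.measurable_partsIntegrand (hf : Tame f M) (hg : Tame g N) (x : ℝ) :
    Measurable (partsIntegrand f g x) := by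
  have h1 : Measurable f := hf.differentiable.continuous.measurable
  have h2 : Measurable (deriv f) := hf.continuous_deriv.measurable
  have h3 : Measurable g := hg.differentiable.continuous.measurable
  have h4 : Measurable (increment f x) :=
    hf.measurable_increment.of_uncurry_left
  unfold partsIntegrand slope
  fun_prop

lemma Tame.integrable_partsIntegrand (hf : Tame f M) (hg : Tame g N) (x : ℝ) :
    Integrable (partsIntegrand f g x) := by
  have hM := hf.nonneg
  have hN := hg.nonneg
  refine (integrable_decayRate_sq.const_mul (2 * N * (4 * M))).mono'
    (hf.measurable_partsIntegrand hg x).aestronglyMeasurable ?_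
  filter_upwards [Measure.ae_ne volume (0 : ℝ)] with α hα
  have h0 := decayRate_nonneg α
  have h1 : |(deriv f (x - α) - slope α f x) / α| ≤ 2 * M * decayRate α :=
    abs_div_le_decayRate (by positivity) (hf.abs_deriv_sub_slope_le hα x).1
      (hf.abs_deriv_sub_slope_le hα x).2
  have h2 : |slopeError α f x| ≤ 2 * M * decayRate α :=
    abs_div_le_decayRate (by positivity) (hf.abs_slope_sub_deriv_le hα x).1
      (hf.abs_slope_sub_deriv_le hα x).2
  refine (abs_partsIntegrand_le f g x α).trans ?_
  calc _ ≤ (2 * N * decayRate α) * (2 * M * decayRate α + 2 * M * decayRate α) := by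
        gcongr
        exact hg.abs_slope_le α x
    _ = _ := by ring

/-- Product rule with `∂_α Δ_α u = (u'(x-α) - Δ_α u)/α`, used for both `g` and `f`. Differentiating
`Δ_α g` produces the integrand of the remainder; everything else involves `g` only through `Δ_α g`.
-/
lemma hasDerivAt_slope_mul_increment (hf : Tame f M) (hg : Tame g N) (x : ℝ) {α : ℝ}
    (hα : α ≠ 0) :
    HasDerivAt (fun α => slope α g x * increment f x α)
      (deriv g (x - α) * (increment f x α / α) + partsIntegrand f g x α) α := by
  have hd : ∀ {u : ℝ → ℝ}, Differentiable ℝ u → HasDerivAt (fun α => slope α u x)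
      ((deriv u (x - α) * α - (u x - u (x - α)) * 1) / α ^ 2) α := fun {u} hu => by
    have h1 : HasDerivAt (fun α => u x - u (x - α)) (deriv u (x - α)) α := by
      have := ((hu (x - α)).hasDerivAt.comp_const_sub x α).const_sub (u x)
      simpa using this
    exact h1.div (hasDerivAt_id α) hα
  have hF : HasDerivAt (fun α => increment f x α) _ α :=
    ((hasDerivAt_F (slope α f x)).comp (h := fun α => slope α f x) α (hd hf.differentiable)).sub_const (F (deriv f x))
  refine ((hd hg.differentiable).mul hF).congr_deriv ?_
  have e : ∀ (u : ℝ → ℝ) , (deriv u (x - α) * α - (u x - u (x - α)) * 1) / α ^ 2 =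
      (deriv u (x - α) - slope α u x) / α := fun u => by
    rw [slope]
    field_simp
  rw [e, e, partsIntegrand]
  ring

/-- The product `Δ_α g · (F(Δ_α f) - F(f'))` is continuous at `0` and decays like `1/|α|`, so
integrating its derivative over the two half-lines leaves no boundary terms. -/
lemma integral_deriv_mul_increment (hf : Tame f M) (hg : Tame g N) (x : ℝ) :
    ∫ α, deriv g (x - α) * (increment f x α / α) = -∫ α, partsIntegrand f g x α := by
  have hM := hf.nonneg
  have hN := hg.nonneg
  have hi := hf.integrable_deriv_mul_increment hg x
  have hj := hf.integrable_partsIntegrand hg x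
  have hij := hi.add hj
  set Q := fun α => slope α g x * increment f x α with hQ
  -- The slope at `α = 0` is `0` by convention; this is also the limit of `Q`, since the increment
  -- is `O(|α|)`.
  have hQ0 : Q 0 = 0 := by simp [hQ, slope]
  have hQ1 : ∀ α, |Q α| ≤ (2 * N) * (2 * M) * |α| := fun α => by
    have e : Q α = slope α g x * (increment f x α / α) * α := by
      rcases eq_or_ne α 0 with rfl | hα
      · simp [hQ0]
      · simp only [hQ]
        field_simp
    have h1 := hg.abs_slope_le α x
    have h2 := hf.abs_increment_div_le x α
    have h3 : decayRate α ≤ 1 := min_le_left _ _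
    rw [e, abs_mul, abs_mul]
    gcongr
    · exact h1.trans (mul_le_of_le_one_right (by positivity) h3)
    · exact h2.trans (mul_le_of_le_one_right (by positivity) h3)
  have hQ2 : ∀ α, |Q α| ≤ (2 * N) * (2 * M) * |α|⁻¹ := fun α => by
    rcases eq_or_ne α 0 with rfl | hα
    · simp [hQ0]
    have h1 : |slope α g x| ≤ 2 * N * |α|⁻¹ :=
      (hg.abs_slope_le α x).trans (by gcongr; exact min_le_right _ _)
    have h2 : |increment f x α| ≤ 2 * M :=
      (abs_F_sub_le _ _).trans (hf.abs_slope_sub_deriv_le hα x).2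
    rw [hQ, abs_mul]
    calc _ ≤ (2 * N * |α|⁻¹) * (2 * M) := by gcongr
      _ = _ := by ring
  have hcont : ContinuousAt Q 0 := by
    rw [ContinuousAt, hQ0]
    refine squeeze_zero_norm hQ1 ?_
    have : Continuous fun α : ℝ => 2 * N * (2 * M) * |α| := by fun_prop
    simpa using this.tendsto 0
  have htop : Tendsto Q atTop (𝓝 0) := by
    refine squeeze_zero_norm hQ2 ?_
    simpa using (tendsto_inv_atTop_zero.comp tendsto_abs_atTop_atTop).const_mul (2 * N * (2 * M))
  have hbot : Tendsto Q atBot (𝓝 0) := by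
    refine squeeze_zero_norm hQ2 ?_
    simpa using (tendsto_inv_atTop_zero.comp tendsto_abs_atBot_atTop).const_mul (2 * N * (2 * M))
  have h1 := integral_Ioi_of_hasDerivAt_of_tendsto hcont.continuousWithinAt
    (fun α hα => hasDerivAt_slope_mul_increment hf hg x (ne_of_gt hα)) hij.integrableOn htop
  have h2 := integral_Iic_of_hasDerivAt_of_tendsto hcont.continuousWithinAt
    (fun α hα => hasDerivAt_slope_mul_increment hf hg x (ne_of_lt hα)) hij.integrableOn hbot
  have h3 := intervalIntegral.integral_Iic_add_Ioi (b := 0) hij.integrableOn hij.integrableOn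
  simp only [Pi.add_apply] at h3
  rw [h1, h2, integral_add hi hj] at h3
  linarith

lemma enorm_remainder_le (hf : Tame f M) (hg : Tame g N) (x : ℝ) :
    ‖remainder f g x‖ₑ ≤ ∫⁻ α, ‖slope α g x‖ₑ * ‖(deriv f (x - α) - slope α f x) / α‖ₑ +
      ‖slope α g x‖ₑ * ‖slopeError α f x‖ₑ := by
  have h1 : ‖remainder f g x‖ₑ ≤ ‖∫ α, partsIntegrand f g x α‖ₑ := by
    rw [remainder_eq hf hg, integral_deriv_mul_increment hf hg, enorm_mul, enorm_neg]
    refine mul_le_of_le_one_left zero_le ?_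
    rw [← ofReal_norm, ENNReal.ofReal_le_one, Real.norm_of_nonneg (by positivity)]
    rw [div_le_one Real.pi_pos]
    linarith [Real.pi_gt_three]
  refine h1.trans ((enorm_integral_le_lintegral_enorm _).trans (lintegral_mono fun α => ?_))
  rw [← mul_add]
  simp only [← ofReal_norm]
  rw [← ENNReal.ofReal_add (norm_nonneg _) (norm_nonneg _),
    ← ENNReal.ofReal_mul (norm_nonneg _)]
  exact ENNReal.ofReal_le_ofReal (abs_partsIntegrand_le f g x α)

lemma stronglyMeasurable_remainder (hf : Tame f M) (hg : Tame g N) :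
    StronglyMeasurable (remainder f g) := by
  have e : remainder f g = fun x =>
      (1 / Real.pi) * ∫ α, deriv g (x - α) * (increment f x α / α) :=
    funext (remainder_eq hf hg)
  have h1 : Measurable fun p : ℝ × ℝ => increment f p.1 p.2 := hf.measurable_increment
  have h2 : Measurable (deriv g) := hg.continuous_deriv.measurable
  have hm : Measurable fun p : ℝ × ℝ => deriv g (p.1 - p.2) * (increment f p.1 p.2 / p.2) := by
    fun_prop
  rw [e]
  exact hm.stronglyMeasurable.integral_prod_right.const_mul _

/-! ### The `L²` estimate -/

/-- Cauchy–Schwarz in `α` leaves `∫ p_α²` times `∫ q_β²` with independent parameters. After Tonelli,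
Cauchy–Schwarz in `x` bounds each `∫ p_α² q_β² dx` by a product of a function of `α` and a function
of `β`. -/
lemma lintegral_sq_lintegral_mul_le {p q : ℝ → ℝ → ℝ≥0∞} (hp : Measurable (Function.uncurry p))
    (hq : Measurable (Function.uncurry q)) :
    ∫⁻ x, (∫⁻ α, p α x * q α x) ^ 2 ≤
      (∫⁻ α, (∫⁻ x, p α x ^ 4) ^ (1 / 2 : ℝ)) * ∫⁻ α, (∫⁻ x, q α x ^ 4) ^ (1 / 2 : ℝ) := by
  have hp1 : Measurable fun a : ℝ × ℝ => p a.1 a.2 := hp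
  have hq1 : Measurable fun a : ℝ × ℝ => q a.1 a.2 := hq
  have hpα : ∀ α, Measurable (p α) := fun α => hp.of_uncurry_left
  have hqα : ∀ α, Measurable (q α) := fun α => hq.of_uncurry_left
  have hpx : ∀ x, Measurable fun α => p α x := fun x => hp.of_uncurry_right
  have hqx : ∀ x, Measurable fun α => q α x := fun x => hq.of_uncurry_right
  have hP : Measurable fun α => (∫⁻ x, p α x ^ 4) ^ (1 / 2 : ℝ) :=
    (Measurable.lintegral_prod_right' (f := fun a : ℝ × ℝ => p a.1 a.2 ^ 4)
      (by fun_prop)).pow_const _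
  have hQ : Measurable fun β => (∫⁻ x, q β x ^ 4) ^ (1 / 2 : ℝ) :=
    (Measurable.lintegral_prod_right' (f := fun a : ℝ × ℝ => q a.1 a.2 ^ 4)
      (by fun_prop)).pow_const _
  have hQ2 : Measurable fun x => ∫⁻ β, q β x ^ 2 :=
    Measurable.lintegral_prod_left' (f := fun a : ℝ × ℝ => q a.1 a.2 ^ 2) (by fun_prop)
  have hQ2' : Measurable fun a : ℝ × ℝ => ∫⁻ β, q β a.2 ^ 2 := hQ2.comp measurable_snd
  calc _ ≤ ∫⁻ x, (∫⁻ α, p α x ^ 2) * ∫⁻ β, q β x ^ 2 :=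
        lintegral_mono fun x => sq_lintegral_mul_le (hpx x) (hqx x)
    _ = ∫⁻ x, ∫⁻ α, p α x ^ 2 * ∫⁻ β, q β x ^ 2 := by
        refine lintegral_congr fun x => ?_
        have := hpx x
        rw [lintegral_mul_const _ (by fun_prop)]
    _ = ∫⁻ α, ∫⁻ x, p α x ^ 2 * ∫⁻ β, q β x ^ 2 := by
        rw [lintegral_lintegral_swap]
        have : Measurable fun a : ℝ × ℝ => p a.2 a.1 ^ 2 * ∫⁻ β, q β a.1 ^ 2 := by
          have h1 : Measurable fun a : ℝ × ℝ => p a.2 a.1 := hp1.comp measurable_swap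
          have h2 : Measurable fun a : ℝ × ℝ => ∫⁻ β, q β a.1 ^ 2 := hQ2.comp measurable_fst
          fun_prop
        exact this.aemeasurable
    _ = ∫⁻ α, ∫⁻ β, ∫⁻ x, p α x ^ 2 * q β x ^ 2 := by
        refine lintegral_congr fun α => ?_
        have h1 := hpα α
        rw [lintegral_lintegral_swap]
        · refine lintegral_congr fun x => ?_
          have := hqx x
          rw [lintegral_const_mul _ (by fun_prop)]
        · have : Measurable fun a : ℝ × ℝ => p α a.2 ^ 2 * q a.1 a.2 ^ 2 := by fun_prop
          exact this.aemeasurable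
    _ ≤ ∫⁻ α, ∫⁻ β, (∫⁻ x, p α x ^ 4) ^ (1 / 2 : ℝ) * (∫⁻ x, q β x ^ 4) ^ (1 / 2 : ℝ) := by
        refine lintegral_mono fun α => lintegral_mono fun β => ?_
        have h1 := hpα α
        have h2 := hqα β
        have h := sq_lintegral_mul_le (μ := volume) (p := fun x => p α x ^ 2)
          (q := fun x => q β x ^ 2) (by fun_prop) (by fun_prop)
        simp only [← pow_mul] at h
        have h3 := ENNReal.rpow_le_rpow h (z := 1 / 2) (by norm_num)
        rw [ENNReal.mul_rpow_of_nonneg _ _ (by norm_num), ← ENNReal.rpow_natCast,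
          ← ENNReal.rpow_mul] at h3
        norm_num at h3 ⊢
        exact h3
    _ = _ := by
        simp_rw [lintegral_const_mul _ hQ]
        rw [lintegral_mul_const _ hP]

/-- Replace `α` by `-α` and translate `x` by `α`: since `Δ_{-α} f(x-α) = Δ_α f(x)`, the error
measured at the far endpoint becomes the error at the near one, up to sign. -/
lemma lintegral_sub_slope_eq (f : ℝ → ℝ) :
    ∫⁻ α, (∫⁻ x, ‖(deriv f (x - α) - slope α f x) / α‖ₑ ^ 4) ^ (1 / 2 : ℝ) =
      ∫⁻ α, (∫⁻ x, ‖slopeError α f x‖ₑ ^ 4) ^ (1 / 2 : ℝ) := by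
  rw [← lintegral_neg_eq_self]
  refine lintegral_congr fun α => ?_
  rw [← lintegral_sub_right_eq_self _ α]
  congr 1
  refine lintegral_congr fun x => ?_
  congr 2
  rw [slopeError, slope, slope, sub_neg_eq_add, sub_add_cancel]
  ring

variable {v w : ℝ → ℂ}

lemma lintegral_remainder_sq_le_slope_mul (hf : HasSpectrum v f) (hg : HasSpectrum w g) :
    ∫⁻ x, ‖remainder f g x‖ₑ ^ 2 ≤ 4 * ((∫⁻ α, (∫⁻ x, ‖slope α g x‖ₑ ^ 4) ^ (1 / 2 : ℝ)) *
      ∫⁻ α, (∫⁻ x, ‖slopeError α f x‖ₑ ^ 4) ^ (1 / 2 : ℝ)) := by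
  obtain ⟨M, hM⟩ := hf.exists_tame
  obtain ⟨N, hN⟩ := hg.exists_tame
  have m1 : Measurable f := hf.continuous.measurable
  have m2 : Measurable (deriv f) := hf.deriv.continuous.measurable
  have m3 : Measurable g := hg.continuous.measurable
  have mp : Measurable (Function.uncurry fun α x => ‖slope α g x‖ₑ) := by
    unfold slope Function.uncurry
    fun_prop
  have mq : Measurable (Function.uncurry fun α x =>
      ‖(deriv f (x - α) - slope α f x) / α‖ₑ) := by
    unfold slope Function.uncurry
    fun_prop
  have mr : Measurable (Function.uncurry fun α x => ‖slopeError α f x‖ₑ) := by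
    unfold slopeError slope Function.uncurry
    fun_prop
  have mpq : Measurable (Function.uncurry fun x α =>
      ‖slope α g x‖ₑ * ‖(deriv f (x - α) - slope α f x) / α‖ₑ) := by
    unfold slope Function.uncurry
    fun_prop
  have mpr : Measurable (Function.uncurry fun x α =>
      ‖slope α g x‖ₑ * ‖slopeError α f x‖ₑ) := by
    unfold slopeError slope Function.uncurry
    fun_prop
  have hsq : ∀ a b : ℝ≥0∞, (a + b) ^ 2 ≤ 2 * a ^ 2 + 2 * b ^ 2 := fun a b => by
    have h := ENNReal.rpow_add_le_mul_rpow_add_rpow a b (p := 2) (by norm_num)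
    rw [← mul_add]
    norm_num at h
    exact h
  have hPQ := lintegral_sq_lintegral_mul_le mp mq
  have hPR := lintegral_sq_lintegral_mul_le mp mr
  rw [lintegral_sub_slope_eq] at hPQ
  calc _ ≤ ∫⁻ x, (2 * (∫⁻ α, ‖slope α g x‖ₑ * ‖(deriv f (x - α) - slope α f x) / α‖ₑ) ^ 2 +
        2 * (∫⁻ α, ‖slope α g x‖ₑ * ‖slopeError α f x‖ₑ) ^ 2) := by
        refine lintegral_mono fun x => ?_
        refine (pow_le_pow_left' (enorm_remainder_le hM hN x) 2).trans ?_
        rw [lintegral_add_left mpq.of_uncurry_left]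
        exact hsq _ _
    _ = (2 * ∫⁻ x, (∫⁻ α, ‖slope α g x‖ₑ * ‖(deriv f (x - α) - slope α f x) / α‖ₑ) ^ 2) +
        2 * ∫⁻ x, (∫⁻ α, ‖slope α g x‖ₑ * ‖slopeError α f x‖ₑ) ^ 2 := by
        have h1 := mpq.lintegral_prod_right (ν := volume)
        have h2 := mpr.lintegral_prod_right (ν := volume)
        rw [lintegral_add_left (by fun_prop), lintegral_const_mul _ (by fun_prop),
          lintegral_const_mul _ (by fun_prop)]
    _ ≤ _ := add_le_add (mul_le_mul_right hPQ 2) (mul_le_mul_right hPR 2)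
    _ = _ := by
        rw [← add_mul]
        norm_num

/-! ### From square functions to homogeneous Sobolev norms -/

/-- The square of the `Ḣ^σ` norm in terms of the spectrum. -/
def spectralEnergy (σ : ℝ) (w : ℝ → ℂ) : ℝ≥0∞ :=
  ∫⁻ ξ, ENNReal.ofReal (|2 * Real.pi * ξ| ^ (2 * σ)) * ‖w ξ‖ₑ ^ 2

lemma one_le_two_pi : 1 ≤ 2 * Real.pi := by linarith [Real.pi_gt_three]

lemma lintegral_slope_le_spectralEnergy (hg : HasSpectrum w g) :
    ∫⁻ α, (∫⁻ x, ‖slope α g x‖ₑ ^ 4) ^ (1 / 2 : ℝ) ≤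
      ENNReal.ofReal (320 * Real.pi) * spectralEnergy (3 / 4) w := by
  have hw := hg.decay.measurable
  rw [spectralEnergy, ← lintegral_const_mul _ (by fun_prop)]
  refine hg.lintegral_slope_le.trans (lintegral_mono fun ξ => ?_)
  rw [← mul_assoc, ← ENNReal.ofReal_mul (by positivity)]
  have h1 : |ξ| ≤ |2 * Real.pi * ξ| := by
    rw [abs_mul, abs_of_pos Real.two_pi_pos]
    exact le_mul_of_one_le_left (abs_nonneg ξ) one_le_two_pi
  rw [show (2 * (3 / 4) : ℝ) = 3 / 2 by norm_num]
  gcongr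

lemma lintegral_slopeError_le_spectralEnergy (hf : HasSpectrum v f) :
    ∫⁻ α, (∫⁻ x, ‖slopeError α f x‖ₑ ^ 4) ^ (1 / 2 : ℝ) ≤
      ENNReal.ofReal (1280 * Real.pi) * spectralEnergy (7 / 4) v := by
  have hw := hf.decay.measurable
  rw [spectralEnergy, ← lintegral_const_mul _ (by fun_prop)]
  refine hf.lintegral_slopeError_le.trans (lintegral_mono fun ξ => ?_)
  rw [← mul_assoc (ENNReal.ofReal _), ← ENNReal.ofReal_mul (by positivity)]
  refine mul_le_mul_left (ENNReal.ofReal_le_ofReal ?_) _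
  have h1 : |ξ| ≤ 2 * Real.pi * |ξ| := le_mul_of_one_le_left (abs_nonneg ξ) one_le_two_pi
  rw [abs_mul, abs_of_pos Real.two_pi_pos, show (2 * (7 / 4) : ℝ) = 3 / 2 + 2 by norm_num,
    Real.rpow_add' (by positivity) (by norm_num), Real.rpow_two]
  have h2 : |ξ| ^ (3 / 2 : ℝ) ≤ (2 * Real.pi * |ξ|) ^ (3 / 2 : ℝ) := by gcongr
  calc _ = (1280 * Real.pi) * (|ξ| ^ (3 / 2 : ℝ) * (2 * Real.pi * |ξ|) ^ 2) := by ring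
    _ ≤ _ := by gcongr

lemma lintegral_remainder_sq_le (hf : HasSpectrum v f) (hg : HasSpectrum w g) :
    ∫⁻ x, ‖remainder f g x‖ₑ ^ 2 ≤
      ENNReal.ofReal ((1280 * Real.pi) ^ 2) * spectralEnergy (3 / 4) w *
        spectralEnergy (7 / 4) v := by
  refine (lintegral_remainder_sq_le_slope_mul hf hg).trans ?_
  calc _ ≤ 4 * ((ENNReal.ofReal (320 * Real.pi) * spectralEnergy (3 / 4) w) *
        (ENNReal.ofReal (1280 * Real.pi) * spectralEnergy (7 / 4) v)) := by
        gcongr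
        · exact lintegral_slope_le_spectralEnergy hg
        · exact lintegral_slopeError_le_spectralEnergy hf
    _ = (ENNReal.ofReal 4 * ENNReal.ofReal (320 * Real.pi) * ENNReal.ofReal (1280 * Real.pi)) *
        spectralEnergy (3 / 4) w * spectralEnergy (7 / 4) v := by
        rw [ENNReal.ofReal_ofNat]
        ring
    _ = _ := by
        rw [← ENNReal.ofReal_mul (by norm_num), ← ENNReal.ofReal_mul (by positivity)]
        congr 3
        ring

lemma RapidDecay.rpow_mul {w : ℝ → ℂ} (hw : RapidDecay w) {r : ℝ} (hr : 0 ≤ r) :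
    RapidDecay fun ξ => ((|2 * Real.pi * ξ| ^ r : ℝ) : ℂ) * w ξ := by
  refine hw.mul_of_le (by fun_prop) ⌈r⌉₊ ((2 * Real.pi) ^ r) fun ξ => ?_
  rw [Complex.norm_real, Real.norm_of_nonneg (by positivity), abs_mul, abs_of_pos Real.two_pi_pos,
    Real.mul_rpow Real.two_pi_pos.le (abs_nonneg ξ)]
  gcongr
  rcases le_total |ξ| 1 with h | h
  · have h1 := Real.rpow_le_one (abs_nonneg ξ) h hr
    have h2 : 0 ≤ |ξ| ^ ⌈r⌉₊ := by positivity
    linarith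
  · have h1 := Real.rpow_le_rpow_of_exponent_le h (Nat.le_ceil r)
    rw [Real.rpow_natCast] at h1
    linarith

lemma spectralEnergy_eq_lintegral (σ : ℝ) (w : ℝ → ℂ) :
    spectralEnergy σ w = ∫⁻ ξ, ‖((|2 * Real.pi * ξ| ^ σ : ℝ) : ℂ) * w ξ‖ₑ ^ 2 := by
  refine lintegral_congr fun ξ => ?_
  rw [enorm_mul, mul_pow]
  congr 1
  rw [← ofReal_norm, Complex.norm_real, Real.norm_of_nonneg (by positivity),
    ← ENNReal.ofReal_pow (by positivity), ← Real.rpow_natCast, ← Real.rpow_mul (abs_nonneg _),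
    Nat.cast_ofNat, mul_comm σ]

lemma RapidDecay.lintegral_enorm_sq {w : ℝ → ℂ} (hw : RapidDecay w) :
    ∫⁻ ξ, ‖w ξ‖ₑ ^ 2 = ENNReal.ofReal (∫ ξ, ‖w ξ‖ ^ 2) := by
  have hi := (memLp_two_iff_integrable_sq_norm hw.measurable.aestronglyMeasurable).1 hw.memLp_two
  rw [ofReal_integral_eq_lintegral_ofReal hi (ae_of_all _ fun ξ => by positivity)]
  refine lintegral_congr fun ξ => ?_
  rw [← ofReal_norm, ENNReal.ofReal_pow (norm_nonneg _)]

/-- The remainder estimate for functions with rapidly decaying spectra. -/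
lemma memLp_remainder_and_le (hf : HasSpectrum v f) (hg : HasSpectrum w g) {a b : ℝ}
    (ha : 0 ≤ a) (hb : 0 ≤ b) (hwa : spectralEnergy (3 / 4) w = ENNReal.ofReal (a ^ 2))
    (hvb : spectralEnergy (7 / 4) v = ENNReal.ofReal (b ^ 2)) :
    RemainderExists f g ∧ MemLp (remainder f g) 2 volume ∧
      l2Norm (remainder f g) ≤ 1280 * Real.pi * a * b := by
  obtain ⟨M, hM⟩ := hf.exists_tame
  obtain ⟨N, hN⟩ := hg.exists_tame
  have h := lintegral_remainder_sq_le hf hg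
  rw [hwa, hvb, ← ENNReal.ofReal_mul (by positivity), ← ENNReal.ofReal_mul (by positivity)] at h
  have hsq : eLpNorm (remainder f g) 2 volume ^ 2 ≤
      ENNReal.ofReal (1280 * Real.pi * a * b) ^ 2 := by
    rw [← ENNReal.ofReal_pow (by positivity)]
    have e := lintegral_enorm_sq_eq fun x => (remainder f g x : ℂ)
    have e' : eLpNorm (fun x => (remainder f g x : ℂ)) 2 volume =
        eLpNorm (remainder f g) 2 volume :=
      eLpNorm_congr_norm_ae (ae_of_all _ fun x => Complex.norm_real _)
    rw [e'] at e
    rw [← e]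
    simp only [← ofReal_norm, Complex.norm_real] at h ⊢
    refine h.trans (le_of_eq ?_)
    congr 1
    ring
  have hle : eLpNorm (remainder f g) 2 volume ≤ ENNReal.ofReal (1280 * Real.pi * a * b) :=
    (ENNReal.pow_le_pow_left_iff two_ne_zero).1 hsq
  refine ⟨remainderExists_of_tame hM hN,
    ⟨(stronglyMeasurable_remainder hM hN).aestronglyMeasurable,
      hle.trans_lt ENNReal.ofReal_lt_top⟩, ?_⟩
  exact ENNReal.toReal_le_of_le_ofReal (by positivity) hle

/-! ### The weight -/

namespace IsWeight

variable {κ : ℝ → ℝ}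

/-- Comparing `κ(r)/log(4+r)` with its value at `0` gives logarithmic growth. The weaker square root
separates variables: `√(t/h) = √t · h^{-1/2}`, and `h^{-1/2}` is integrable at `0`. -/
lemma exists_le_sqrt (hκ : IsWeight κ) :
    ∃ A, 0 ≤ A ∧ ∀ r, 0 ≤ r → κ r ≤ A * (1 + √r) := by
  have hlog : 0 < Real.log 4 := Real.log_pos (by norm_num)
  have h0 : 0 ≤ κ 0 := zero_le_one.trans (hκ.one_le 0 le_rfl)
  refine ⟨κ 0 / Real.log 4 * 4, by positivity, fun r hr => ?_⟩
  have hlr : 0 < Real.log (4 + r) := Real.log_pos (by linarith)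
  have h1 : κ r / Real.log (4 + r) ≤ κ 0 / Real.log 4 := by
    simpa using hκ.antitoneOn_div_log (mem_Ici.2 le_rfl) (mem_Ici.2 hr) hr
  have h2 : Real.log (4 + r) ≤ 4 * (1 + √r) := by
    have h3 : Real.log (√(4 + r)) ≤ √(4 + r) :=
      (Real.log_le_sub_one_of_pos (Real.sqrt_pos.2 (by linarith))).trans (by linarith)
    rw [Real.log_sqrt (by linarith)] at h3
    have h4 : √(4 + r) ≤ 2 + √r := by
      refine Real.sqrt_le_iff.2 ⟨by positivity, ?_⟩
      nlinarith [Real.sq_sqrt hr, Real.sqrt_nonneg r]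
    linarith [Real.sqrt_nonneg r]
  calc κ r ≤ κ 0 / Real.log 4 * Real.log (4 + r) := (div_le_iff₀ hlr).1 h1
    _ ≤ κ 0 / Real.log 4 * (4 * (1 + √r)) := by gcongr
    _ = _ := by ring

end IsWeight

/-- An integrable majorant of the kernel defining `phi`. -/
def phiMajorant (h : ℝ) : ℝ := min 1 (2 / h ^ 2) * (1 + h ^ (-(1 / 2) : ℝ))

lemma integrableOn_phiMajorant : IntegrableOn phiMajorant (Ioi 0) := by
  have hm : Measurable phiMajorant := by unfold phiMajorant; fun_prop
  have h1 : IntegrableOn phiMajorant (Ioc 0 1) := by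
    have hi : IntegrableOn (fun h : ℝ => 1 + h ^ (-(1 / 2) : ℝ)) (Ioc 0 1) :=
      (integrableOn_const (by simp)).add ((intervalIntegrable_iff_integrableOn_Ioc_of_le
        zero_le_one).1 (intervalIntegral.intervalIntegrable_rpow' (by norm_num)))
    refine Integrable.mono' hi hm.aestronglyMeasurable
      ((ae_restrict_iff' measurableSet_Ioc).2 (ae_of_all _ fun h hh => ?_))
    have h0 : 0 ≤ h ^ (-(1 / 2) : ℝ) := Real.rpow_nonneg hh.1.le _
    have h0' : 0 ≤ min 1 (2 / h ^ 2) := le_min zero_le_one (by positivity)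
    rw [phiMajorant, Real.norm_of_nonneg (by positivity)]
    exact mul_le_of_le_one_left (by positivity) (min_le_left _ _)
  have h2 : IntegrableOn phiMajorant (Ioi 1) := by
    have hi : IntegrableOn (fun h : ℝ => 4 * h ^ (-2 : ℝ)) (Ioi 1) :=
      (integrableOn_Ioi_rpow_of_lt (by norm_num) one_pos).const_mul 4
    refine Integrable.mono' hi hm.aestronglyMeasurable
      ((ae_restrict_iff' measurableSet_Ioi).2 (ae_of_all _ fun h hh => ?_))
    have hpos : 0 < h := one_pos.trans hh
    have h0 : 0 ≤ h ^ (-(1 / 2) : ℝ) := Real.rpow_nonneg hpos.le _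
    have h1 : h ^ (-(1 / 2) : ℝ) ≤ 1 :=
      Real.rpow_le_one_of_one_le_of_nonpos (le_of_lt hh) (by norm_num)
    have h0' : 0 ≤ min 1 (2 / h ^ 2) := le_min zero_le_one (by positivity)
    rw [phiMajorant, Real.norm_of_nonneg (by positivity)]
    calc _ ≤ 2 / h ^ 2 * (1 + 1) := by gcongr; exact min_le_right _ _
      _ = _ := by
        rw [Real.rpow_neg hpos.le, Real.rpow_two]
        ring
  rw [← Ioc_union_Ioi_eq_Ioi zero_le_one]
  exact h1.union h2

lemma phiKernel_nonneg (h : ℝ) : 0 ≤ (1 - Real.cos h) / h ^ 2 :=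
  div_nonneg (by linarith [Real.cos_le_one h]) (sq_nonneg h)

lemma phiKernel_le {h : ℝ} (hh : 0 < h) : (1 - Real.cos h) / h ^ 2 ≤ min 1 (2 / h ^ 2) := by
  rw [le_min_iff]
  constructor
  · rw [div_le_one (by positivity)]
    have := Real.one_sub_sq_div_two_le_cos (x := h)
    nlinarith [sq_nonneg h]
  · gcongr
    linarith [Real.neg_one_le_cos h]

namespace IsWeight

variable {κ : ℝ → ℝ}

lemma nonneg (hκ : IsWeight κ) {r : ℝ} (hr : 0 ≤ r) : 0 ≤ κ r :=
  zero_le_one.trans (hκ.one_le r hr)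

lemma exists_phiIntegrand_le (hκ : IsWeight κ) : ∃ A, 0 ≤ A ∧ ∀ t, 0 ≤ t → ∀ h, 0 < h →
    (1 - Real.cos h) / h ^ 2 * κ (t / h) ≤ A * (1 + √t) * phiMajorant h := by
  obtain ⟨A, hA, hle⟩ := hκ.exists_le_sqrt
  refine ⟨A, hA, fun t ht h hh => ?_⟩
  have h0 : 0 ≤ h ^ (-(1 / 2) : ℝ) := Real.rpow_nonneg hh.le _
  have e : √(t / h) = √t * h ^ (-(1 / 2) : ℝ) := by
    rw [Real.sqrt_div ht, Real.rpow_neg hh.le, ← Real.sqrt_eq_rpow, div_eq_mul_inv]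
  have h1 : κ (t / h) ≤ A * (1 + √t) * (1 + h ^ (-(1 / 2) : ℝ)) := by
    refine (hle _ (by positivity)).trans ?_
    rw [e, mul_assoc]
    gcongr
    nlinarith [Real.sqrt_nonneg t, mul_nonneg (Real.sqrt_nonneg t) h0]
  have h0' : 0 ≤ min 1 (2 / h ^ 2) := le_min zero_le_one (by positivity)
  calc _ ≤ min 1 (2 / h ^ 2) * (A * (1 + √t) * (1 + h ^ (-(1 / 2) : ℝ))) :=
        mul_le_mul (phiKernel_le hh) h1 (hκ.nonneg (by positivity)) h0'
    _ = _ := by rw [phiMajorant]; ring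

lemma integrableOn_phiIntegrand (hκ : IsWeight κ) {t : ℝ} (ht : 0 ≤ t) :
    IntegrableOn (fun h => (1 - Real.cos h) / h ^ 2 * κ (t / h)) (Ioi 0) := by
  obtain ⟨A, hA, hle⟩ := hκ.exists_phiIntegrand_le
  -- Only the values of `κ` on `[0,∞)` are constrained, so measurability comes from the monotone
  -- extension that is constant on the negative axis.
  have hmono : Monotone fun r => κ (max r 0) := fun a b hab =>
    hκ.monotoneOn (mem_Ici.2 (le_max_right _ _)) (mem_Ici.2 (le_max_right _ _))
      (max_le_max hab le_rfl)
  have hκm : Measurable fun r => κ (max r 0) := hmono.measurable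
  have hm : Measurable fun h => (1 - Real.cos h) / h ^ 2 * κ (max (t / h) 0) := by
    have : Measurable fun h => κ (max (t / h) 0) := hκm.comp (by fun_prop)
    exact Measurable.mul (by fun_prop) this
  refine Integrable.mono' (integrableOn_phiMajorant.const_mul (A * (1 + √t))) ?_
    ((ae_restrict_iff' measurableSet_Ioi).2 (ae_of_all _ fun h (hh : 0 < h) => ?_))
  · refine hm.aestronglyMeasurable.congr
      ((ae_restrict_iff' measurableSet_Ioi).2 (ae_of_all _ fun h (hh : 0 < h) => ?_))
    simp only [max_eq_left (div_nonneg ht hh.le)]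
  · rw [Real.norm_of_nonneg (mul_nonneg (phiKernel_nonneg h) (hκ.nonneg (div_nonneg ht hh.le)))]
    exact hle t ht h hh

lemma monotoneOn_phi (hκ : IsWeight κ) : MonotoneOn (phi κ) (Ici 0) := by
  intro s hs t ht hst
  refine setIntegral_mono_on (hκ.integrableOn_phiIntegrand hs) (hκ.integrableOn_phiIntegrand ht)
    measurableSet_Ioi fun h (hh : 0 < h) => ?_
  refine mul_le_mul_of_nonneg_left (hκ.monotoneOn ?_ ?_ ?_) (phiKernel_nonneg h)
  · exact div_nonneg hs hh.le
  · exact div_nonneg ht hh.le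
  · gcongr

lemma phi_nonneg (hκ : IsWeight κ) {t : ℝ} (ht : 0 ≤ t) : 0 ≤ phi κ t :=
  setIntegral_nonneg measurableSet_Ioi fun h (hh : 0 < h) =>
    mul_nonneg (phiKernel_nonneg h) (hκ.nonneg (div_nonneg ht hh.le))

/-- Polynomial growth is all that is needed for multiplication by `φ` to preserve rapid decay; the
square-root bound is relaxed to a linear one. -/
lemma exists_phi_le (hκ : IsWeight κ) : ∃ B, 0 ≤ B ∧ ∀ t, 0 ≤ t → phi κ t ≤ B * (1 + t) := by
  obtain ⟨A, hA, hle⟩ := hκ.exists_phiIntegrand_le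
  have hI : 0 ≤ ∫ h in Ioi (0 : ℝ), phiMajorant h :=
    setIntegral_nonneg measurableSet_Ioi fun h (hh : 0 < h) => by
      unfold phiMajorant
      have := Real.rpow_nonneg hh.le (-(1 / 2))
      positivity
  refine ⟨A * 2 * ∫ h in Ioi (0 : ℝ), phiMajorant h, by positivity, fun t ht => ?_⟩
  have h1 : phi κ t ≤ A * (1 + √t) * ∫ h in Ioi (0 : ℝ), phiMajorant h := by
    rw [← integral_const_mul]
    exact setIntegral_mono_on (hκ.integrableOn_phiIntegrand ht)
      (integrableOn_phiMajorant.const_mul _) measurableSet_Ioi fun h hh => hle t ht h hh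
  have h2 : 1 + √t ≤ 2 * (1 + t) := by
    nlinarith [Real.sq_sqrt ht, sq_nonneg (√t - 1)]
  calc _ ≤ A * (2 * (1 + t)) * ∫ h in Ioi (0 : ℝ), phiMajorant h := h1.trans (by gcongr)
    _ = _ := by ring

lemma measurable_phi_abs (hκ : IsWeight κ) : Measurable fun ξ : ℝ => phi κ |2 * Real.pi * ξ| := by
  have hmono : Monotone fun t => phi κ (max t 0) := fun a b hab =>
    hκ.monotoneOn_phi (mem_Ici.2 (le_max_right _ _)) (mem_Ici.2 (le_max_right _ _))
      (max_le_max hab le_rfl)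
  have := hmono.measurable.comp (show Measurable fun ξ : ℝ => |2 * Real.pi * ξ| by fun_prop)
  have e : ∀ ξ : ℝ, max |2 * Real.pi * ξ| 0 = |2 * Real.pi * ξ| := fun ξ =>
    max_eq_left (abs_nonneg _)
  simpa only [Function.comp_def, e] using this

end IsWeight

lemma RapidDecay.phi_mul {κ : ℝ → ℝ} (hκ : IsWeight κ) {w : ℝ → ℂ} (hw : RapidDecay w) :
    RapidDecay fun ξ => ((phi κ |2 * Real.pi * ξ| : ℝ) : ℂ) * w ξ := by
  obtain ⟨B, hB, hle⟩ := hκ.exists_phi_le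
  refine hw.mul_of_le (Complex.measurable_ofReal.comp hκ.measurable_phi_abs) 1
    (B * (2 * Real.pi)) fun ξ => ?_
  rw [Complex.norm_real, Real.norm_of_nonneg (hκ.phi_nonneg (abs_nonneg _))]
  refine (hle _ (abs_nonneg _)).trans ?_
  rw [abs_mul, abs_of_pos Real.two_pi_pos, mul_assoc B, pow_one]
  refine mul_le_mul_of_nonneg_left ?_ hB
  linarith [one_le_two_pi]

/-! ### Schwartz functions and multipliers -/

/-- The function whose Fourier transform is `u`. -/
def spectrumOf (u : ℝ → ℝ) (ξ : ℝ) : ℂ := hat u (-(2 * Real.pi) * ξ)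

lemma spectrumOf_eq (u : ℝ → ℝ) : spectrumOf u = 𝓕⁻ fun x : ℝ => (u x : ℂ) := by
  ext ξ
  rw [spectrumOf, hat, Real.fourierInv_eq_fourier_neg]
  have := Real.pi_ne_zero
  field_simp

/-- The spectrum is the inverse Fourier transform of `f`, again a Schwartz function. -/
lemma hasSpectrum_schwartz (f : SchwartzMap ℝ ℝ) : HasSpectrum (spectrumOf f) f := by
  let F : SchwartzMap ℝ ℂ := f.postcompCLM Complex.ofRealCLM
  have hF : (fun x : ℝ => (f x : ℂ)) = F := rfl
  rw [spectrumOf_eq, hF, ← SchwartzMap.fourierInv_coe]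
  refine ⟨⟨(𝓕⁻ F).continuous.measurable, fun n => ?_⟩, fun x => ?_⟩
  · obtain ⟨C, -, hC⟩ := (𝓕⁻ F).decay n 0
    refine ⟨C, fun ξ => ?_⟩
    simpa using hC ξ
  · rw [← SchwartzMap.fourier_coe, FourierTransform.fourier_fourierInv_eq]
    rfl

lemma integral_comp_neg_two_pi_mul {E : Type*} [NormedAddCommGroup E] [NormedSpace ℝ E]
    (G : ℝ → E) : ∫ ξ, G (-(2 * Real.pi) * ξ) = (2 * Real.pi)⁻¹ • ∫ ξ, G ξ := by
  rw [Measure.integral_comp_mul_left, inv_neg, abs_neg,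
    abs_of_pos (inv_pos.2 Real.two_pi_pos)]

lemma abs_neg_two_pi_mul (ξ : ℝ) : |-(2 * Real.pi) * ξ| = |2 * Real.pi * ξ| := by
  rw [neg_mul, abs_neg]

lemma spectralEnergy_spectrumOf (f : SchwartzMap ℝ ℝ) {σ : ℝ} (hσ : 0 ≤ σ) :
    spectralEnergy σ (spectrumOf f) = ENNReal.ofReal (hDotNorm σ f ^ 2) := by
  have hr := (hasSpectrum_schwartz f).decay.rpow_mul hσ
  rw [spectralEnergy_eq_lintegral, hr.lintegral_enorm_sq, hDotNorm, Real.sq_sqrt (by positivity),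
    ← smul_eq_mul (2 * Real.pi)⁻¹, ← integral_comp_neg_two_pi_mul]
  congr 1
  refine integral_congr_ae (ae_of_all _ fun ξ => ?_)
  simp only [spectrumOf, norm_mul, Complex.norm_real, abs_neg_two_pi_mul, mul_pow]
  rw [Real.norm_of_nonneg (by positivity), ← Real.rpow_natCast, ← Real.rpow_mul (abs_nonneg _),
    Nat.cast_ofNat, mul_comm σ]

lemma HasSpectrum.memLp_two {w : ℝ → ℂ} {u : ℝ → ℝ} (h : HasSpectrum w u) : MemLp u 2 := by
  rw [memLp_two_iff_integrable_sq h.continuous.aestronglyMeasurable]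
  exact h.integrable_sq

lemma HasSpectrum.ofReal_l2Norm_sq {w : ℝ → ℂ} {u : ℝ → ℝ} (h : HasSpectrum w u) :
    ENNReal.ofReal (l2Norm u ^ 2) = ∫⁻ ξ, ‖w ξ‖ₑ ^ 2 := by
  rw [← h.decay.lintegral_fourier, lintegral_enorm_sq_eq, l2Norm,
    ENNReal.ofReal_pow ENNReal.toReal_nonneg, ENNReal.ofReal_toReal h.memLp_two.eLpNorm_ne_top]
  congr 1
  exact eLpNorm_congr_norm_ae (ae_of_all _ fun x => by rw [← h.eq, Complex.norm_real])

variable {κ : ℝ → ℝ}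

/-- The spectrum of `|D|^{s,φ} f`. -/
def multiplierSpectrum (κ : ℝ → ℝ) (s : ℝ) (f : ℝ → ℝ) (ξ : ℝ) : ℂ :=
  ((|2 * Real.pi * ξ| ^ s : ℝ) : ℂ) * (((phi κ |2 * Real.pi * ξ| : ℝ) : ℂ) * spectrumOf f ξ)

lemma multiplierHat_comp (κ : ℝ → ℝ) (s : ℝ) (f : ℝ → ℝ) (ξ : ℝ) :
    multiplierHat s (phi κ) f (-(2 * Real.pi) * ξ) = multiplierSpectrum κ s f ξ := by
  rw [multiplierHat, multiplierSpectrum, spectrumOf, abs_neg_two_pi_mul, Complex.ofReal_mul,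
    mul_assoc]

lemma rapidDecay_multiplierSpectrum (hκ : IsWeight κ) {s : ℝ} (hs : 0 ≤ s)
    (f : SchwartzMap ℝ ℝ) : RapidDecay (multiplierSpectrum κ s f) :=
  (RapidDecay.phi_mul hκ (hasSpectrum_schwartz f).decay).rpow_mul hs

lemma integrable_multiplierHat (hκ : IsWeight κ) {s : ℝ} (hs : 0 ≤ s) (f : SchwartzMap ℝ ℝ) :
    Integrable (multiplierHat s (phi κ) f) := by
  have h := (rapidDecay_multiplierSpectrum hκ hs f).integrable
  rw [← integrable_comp_mul_left_iff _ (neg_ne_zero.2 Real.two_pi_pos.ne')]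
  simpa only [multiplierHat_comp] using h

lemma hasSpectrum_multiplier (hκ : IsWeight κ) {s : ℝ} (hs : 0 ≤ s) (f : SchwartzMap ℝ ℝ) :
    HasSpectrum (multiplierSpectrum κ s f) (multiplier s (phi κ) f) := by
  refine ⟨rapidDecay_multiplierSpectrum hκ hs f, fun x => ?_⟩
  rw [ofReal_multiplier, multiplierC, Real.fourier_real_eq_integral_exp_smul]
  have h := integral_comp_neg_two_pi_mul fun ξ : ℝ =>
    Complex.exp (Complex.I * (x : ℂ) * (ξ : ℂ)) * multiplierHat s (phi κ) f ξ
  simp only [multiplierHat_comp] at h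
  rw [Complex.real_smul] at h
  push_cast at h
  rw [← h]
  congr 1
  ext ξ
  rw [smul_eq_mul]
  congr 2
  push_cast
  ring

/-- Plancherel together with `3/4 + 1 = 7/4` in the exponent of the symbol. -/
lemma spectralEnergy_multiplierSpectrum (hκ : IsWeight κ) (f : SchwartzMap ℝ ℝ) :
    spectralEnergy (3 / 4) (multiplierSpectrum κ 1 f) =
      ENNReal.ofReal (l2Norm (multiplier (7 / 4) (phi κ) f) ^ 2) := by
  rw [(hasSpectrum_multiplier hκ (by norm_num) f).ofReal_l2Norm_sq, spectralEnergy_eq_lintegral]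
  refine lintegral_congr fun ξ => ?_
  rw [multiplierSpectrum, multiplierSpectrum, ← mul_assoc, ← Complex.ofReal_mul,
    ← Real.rpow_add' (abs_nonneg _) (by norm_num)]
  norm_num

end Muskat

end

theorem proposition2p7 (κ : ℝ → ℝ) (hκ : Muskat.IsWeight κ) :
    ∃ C : ℝ, 0 < C ∧
      (∀ f g : SchwartzMap ℝ ℝ,
        Muskat.RemainderExists f g ∧
        MemLp (Muskat.remainder f g) 2 volume ∧
        Muskat.l2Norm (Muskat.remainder f g) ≤
          C * Muskat.hDotNorm (3 / 4) g * Muskat.hDotNorm (7 / 4) f) ∧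
      (∀ f : SchwartzMap ℝ ℝ,
        Integrable (Muskat.multiplierHat 1 (Muskat.phi κ) f) ∧
        Integrable (Muskat.multiplierHat (7 / 4) (Muskat.phi κ) f) ∧
        MemLp (Muskat.multiplier (7 / 4) (Muskat.phi κ) f) 2 volume ∧
        Muskat.RemainderExists f (Muskat.multiplier 1 (Muskat.phi κ) f) ∧
        MemLp (Muskat.remainder f (Muskat.multiplier 1 (Muskat.phi κ) f)) 2 volume ∧
        Muskat.l2Norm (Muskat.remainder f (Muskat.multiplier 1 (Muskat.phi κ) f)) ≤
          C * Muskat.l2Norm (Muskat.multiplier (7 / 4) (Muskat.phi κ) f) *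
            Muskat.hDotNorm (7 / 4) f) := by
  -- The square of the constant is `4 · 320π · 1280π`: the `4` comes from squaring a sum of two
  -- terms, the others from the two square functions. The prefactor `1/π` was bounded by `1`.
  refine ⟨1280 * Real.pi, by positivity, fun f g => ?_, fun f => ?_⟩
  · exact Muskat.memLp_remainder_and_le (Muskat.hasSpectrum_schwartz f)
      (Muskat.hasSpectrum_schwartz g) (Real.sqrt_nonneg _) (Real.sqrt_nonneg _)
      (Muskat.spectralEnergy_spectrumOf g (by norm_num))
      (Muskat.spectralEnergy_spectrumOf f (by norm_num))
  · exact ⟨Muskat.integrable_multiplierHat hκ zero_le_one f,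
      Muskat.integrable_multiplierHat hκ (by norm_num) f,
      (Muskat.hasSpectrum_multiplier hκ (by norm_num) f).memLp_two,
      Muskat.memLp_remainder_and_le (Muskat.hasSpectrum_schwartz f)
        (Muskat.hasSpectrum_multiplier hκ zero_le_one f) ENNReal.toReal_nonneg
        (Real.sqrt_nonneg _) (Muskat.spectralEnergy_multiplierSpectrum hκ f)
        (Muskat.spectralEnergy_spectrumOf f (by norm_num))⟩
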